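/- Let $\mathbb{K}$ be a field and $q\in\mathbb{K}$ a non-zero scalar. For $n\ge 1$ let $V_n=\mathbb{K}^n$ with basis $e_1,\dots,e_n$, and let $R_n$ be the endomorphism of $V_n\otimes V_n$ with $R_n(e_i\otimes e_j)=e_j\otimes e_i$ if $i<j$, $R_n(e_i\otimes e_i)=q\,e_i\otimes e_i$, and $R_n(e_i\otimes e_j)=(q-q^{-1})\,e_i\otimes e_j+e_j\otimes e_i$ if $i>j$. The Hecke algebra $\mathcal{H}_d$, with generators $T_1,\dots,T_{d-1}$, acts on $V_n^{\otimes d}$ by letting $T_i$ act as $\mathrm{Id}^{\otimes i-1}\otimes R_n\otimes\mathrm{Id}^{\otimes d-i-1}$. Let $S_q(n,m;d)=\mathrm{Hom}_{\mathcal{H}_d}(V_n^{\otimes d},V_m^{\otimes d})$, and let $\mathcal{C}_d$ be the $\mathbb{K}$-linear category with objects $V_n^{\otimes d}$, $n\ge 1$, and with these spaces of morphisms. A homogeneous quantum polynomial functor of degree $d\ge 0$ is a $\mathbb{K}$-linear functor $F$ from $\mathcal{C}_d$ to finite dimensional $\mathbb{K}$-vector spaces; write $F(n)=F(V_n^{\otimes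 d})$. They form an abelian category $\mathcal{P}_q^d$, and the category of quantum polynomial functors is the direct sum $\mathcal{P}_q=\bigoplus_{d\ge 0}\mathcal{P}_q^d$: its objects are the families $(A_d)_{d\ge 0}$ with $A_d\in\mathcal{P}_q^d$ and $A_d=0$ for all but finitely many $d$, and its morphisms are the families of morphisms. The tensor product of $F\in\mathcal{P}_q^{d_1}$ and $G\in\mathcal{P}_q^{d_2}$ is the functor $F\otimes G\in\mathcal{P}_q^{d_1+d_2}$ with $(F\otimes G)(n)=F(n)\otimes G(n)$ and $(F\otimes G)(f)=\sum F(f_1)\otimes G(f_2)$, where $f=\sum f_1\otimes f_2$ is the decomposition of $f\in S_q(n,m;d_1+d_2)$ in $S_q(n,m;d_1)\otimes S_q(n,m;d_2)$. A composition $\alpha=(\alpha_1,\dots,\alpha_n)$ of $d$ into $n$ parts $\alpha_i\geq 0$ is a weight of $A\in\mathcal{P}_q$ if $A_d(\xi_\alpha)\ne 0$, where $\xi_\alpha\in S_q(n,n;d)$ is the projector of $V_n^{\otimes d}$ onto the span of those $e_{i_1}\otimes\cdots\otimes e_{i_d}$ in which each index $j$ occurs exactly $\alpha_j$ times, along the span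 of the other basis vectors. Let $k\ge 0$ and let $A\in\mathcal{P}_q$ be such that every weight of $A$ has at most $k$ non-zero parts. Let $F_1,\dots,F_{k+1}$ be homogeneous quantum polynomial functors of degrees $\ge 1$. Then $$\mathrm{Ext}^s_{\mathcal{P}_q}(A,F_1\otimes\cdots\otimes F_{k+1})=0\qquad\text{for all } s\ge 0.$$ -/

import Mathlib

open CategoryTheory Limits
open scoped TensorProduct

universe u

noncomputable section

namespace QuantumFunctor

/-! ### The spaces `V_n^{⊗ d}` and the Hecke operators -/

section Hecke

variable {K : Type u} [Field K]

/-- The `d`-th tensor power of `V_n = K^n`. -/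
def TensorSpace (K : Type u) [Field K] (n d : ℕ) : Type u := ⨂[K]^d (Fin n → K)

instance (n d : ℕ) : AddCommGroup (TensorSpace K n d) :=
  inferInstanceAs (AddCommGroup (⨂[K]^d (Fin n → K)))

instance (n d : ℕ) : Module K (TensorSpace K n d) :=
  inferInstanceAs (Module K (⨂[K]^d (Fin n → K)))

/-- The basis `e_w = e_{w 0} ⊗ ⋯ ⊗ e_{w (d - 1)}` of `V_n^{⊗ d}`, indexed by words `w` of
length `d` in `n` letters. -/
def wordBasis (K : Type u) [Field K] (n d : ℕ) :
    Module.Basis (Fin d → Fin n) K (TensorSpace K n d) :=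
  Basis.piTensorProduct fun _ => Pi.basisFun K (Fin n)

theorem wordBasis_apply (n d : ℕ) (w : Fin d → Fin n) :
    wordBasis K n d w =
      (PiTensorProduct.tprod K fun i => Pi.basisFun K (Fin n) (w i) : ⨂[K]^d (Fin n → K)) :=
  Basis.piTensorProduct_apply _ _

instance (n d : ℕ) : Module.Finite K (TensorSpace K n d) :=
  Module.Finite.of_basis (wordBasis K n d)

/-- The word obtained by exchanging the letters in positions `i` and `i + 1`. -/
def swapWord {n d : ℕ} (i : ℕ) (hi : i + 1 < d) (w : Fin d → Fin n) : Fin d → Fin n :=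
  w ∘ Equiv.swap ⟨i, Nat.lt_of_succ_lt hi⟩ ⟨i + 1, hi⟩

/-- The action of a generator of the Hecke algebra on `V_n^{⊗ d}` : the operator
`Id ⊗ R_n ⊗ Id`, where the Yang-Baxter operator `R_n` acts on the factors in positions
`i` and `i + 1` (counted from `0`). Explicitly, `R_n (e_a ⊗ e_b)` is `e_b ⊗ e_a` if `a < b`,
`q e_b ⊗ e_a` if `a = b`, and `(q - q⁻¹) e_a ⊗ e_b + e_b ⊗ e_a` if `a > b`. -/
def heckeT (q : K) (n d : ℕ) (i : ℕ) (hi : i + 1 < d) :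
    TensorSpace K n d →ₗ[K] TensorSpace K n d :=
  (wordBasis K n d).constr K fun w =>
    if w ⟨i, Nat.lt_of_succ_lt hi⟩ < w ⟨i + 1, hi⟩ then
      wordBasis K n d (swapWord i hi w)
    else if w ⟨i, Nat.lt_of_succ_lt hi⟩ = w ⟨i + 1, hi⟩ then
      q • wordBasis K n d (swapWord i hi w)
    else
      (q - q⁻¹) • wordBasis K n d w + wordBasis K n d (swapWord i hi w)

/-- The rectangular `q`-Schur bimodule `S_q(n, m; d)` : the space of linear maps
`V_n^{⊗ d} → V_m^{⊗ d}` that are linear over the Hecke algebra, that is, that commute with the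
action of its generators. -/
def schur (q : K) (n m d : ℕ) : Submodule K (TensorSpace K n d →ₗ[K] TensorSpace K m d) where
  carrier := {f | ∀ (i : ℕ) (hi : i + 1 < d), f ∘ₗ heckeT q n d i hi = heckeT q m d i hi ∘ₗ f}
  add_mem' := by
    intro f g hf hg i hi
    rw [LinearMap.add_comp, LinearMap.comp_add, hf i hi, hg i hi]
  zero_mem' := by
    intro i hi
    rw [LinearMap.zero_comp, LinearMap.comp_zero]
  smul_mem' := by
    intro c f hf i hi
    rw [LinearMap.smul_comp, LinearMap.comp_smul, hf i hi]

/-- The identity as an element of `S_q(n, n; d)`. -/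
def schurId (q : K) (n d : ℕ) : schur q n n d :=
  ⟨LinearMap.id, fun i hi => by rw [LinearMap.id_comp, LinearMap.comp_id]⟩

/-- The composition `S_q(r, m; d) × S_q(n, r; d) → S_q(n, m; d)`. -/
def schurComp {q : K} {n r m d : ℕ} (g : schur q r m d) (f : schur q n r d) : schur q n m d :=
  ⟨g.1 ∘ₗ f.1, fun i hi => by
    rw [LinearMap.comp_assoc, f.2 i hi, ← LinearMap.comp_assoc, g.2 i hi, LinearMap.comp_assoc]⟩

/-! ### The weight idempotents -/

/-- The composition of `d` attached to a word: how often each letter occurs. -/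
def content {n d : ℕ} (w : Fin d → Fin n) : Fin n → ℕ :=
  fun j => (Finset.univ.filter fun i => w i = j).card

theorem content_swapWord {n d : ℕ} (i : ℕ) (hi : i + 1 < d) (w : Fin d → Fin n) :
    content (swapWord i hi w) = content w := by
  funext j
  unfold content swapWord
  refine Finset.card_equiv (Equiv.swap ⟨i, Nat.lt_of_succ_lt hi⟩ ⟨i + 1, hi⟩) ?_
  intro a
  simp

/-- The projector of `V_n^{⊗ d} = ⨁_β V_β` onto `V_α`. The Hecke submodule `V_α` generated by
`e_1^{⊗ α_1} ⊗ ⋯ ⊗ e_n^{⊗ α_n}` is spanned by the basis vectors `e_w` such that `w` has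
content `α`. -/
def weightProj (K : Type u) [Field K] (n d : ℕ) (α : Fin n → ℕ) :
    TensorSpace K n d →ₗ[K] TensorSpace K n d :=
  (wordBasis K n d).constr K fun w => if content w = α then wordBasis K n d w else 0

/-- The idempotent `ξ_α` of the `q`-Schur algebra `S_q(n, n; d)`. -/
def xi (q : K) (n d : ℕ) (α : Fin n → ℕ) : schur q n n d :=
  ⟨weightProj K n d α, by
    intro i hi
    refine (wordBasis K n d).ext fun w => ?_
    have h := content_swapWord i hi w
    simp only [LinearMap.comp_apply, heckeT, weightProj, Module.Basis.constr_basis]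
    split_ifs <;> simp only [map_add, map_smul, map_zero, Module.Basis.constr_basis] <;>
      simp_all only [if_true, if_false, smul_zero, add_zero, lt_irrefl]⟩

/-! ### The comultiplication of the `q`-Schur bimodules -/

/-- The identification `V_n^{⊗ d₁} ⊗ V_n^{⊗ d₂} = V_n^{⊗ (d₁ + d₂)}` by concatenation. -/
def concat (K : Type u) [Field K] (n d₁ d₂ : ℕ) :
    TensorSpace K n d₁ ⊗[K] TensorSpace K n d₂ ≃ₗ[K] TensorSpace K n (d₁ + d₂) :=
  TensorPower.mulEquiv

theorem concat_wordBasis {n d₁ d₂ : ℕ} (w₁ : Fin d₁ → Fin n) (w₂ : Fin d₂ → Fin n) :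
    concat K n d₁ d₂ (wordBasis K n d₁ w₁ ⊗ₜ wordBasis K n d₂ w₂) =
      wordBasis K n (d₁ + d₂) (Fin.append w₁ w₂) := by
  rw [wordBasis_apply, wordBasis_apply, wordBasis_apply]
  refine (TensorPower.tprod_mul_tprod K _ _).trans ?_
  refine congrArg (PiTensorProduct.tprod K) (funext fun i => ?_)
  refine Fin.addCases (fun i => ?_) (fun i => ?_) i <;> simp

theorem swapWord_append_left {n d₁ d₂ : ℕ} (i : ℕ) (hi : i + 1 < d₁) (hi' : i + 1 < d₁ + d₂)
    (w₁ : Fin d₁ → Fin n) (w₂ : Fin d₂ → Fin n) :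
    swapWord i hi' (Fin.append w₁ w₂) = Fin.append (swapWord i hi w₁) w₂ := by
  funext a
  refine Fin.addCases (fun a => ?_) (fun a => ?_) a
  · have : Equiv.swap (⟨i, by omega⟩ : Fin (d₁ + d₂)) ⟨i + 1, hi'⟩ (Fin.castAdd d₂ a) =
        Fin.castAdd d₂ (Equiv.swap (⟨i, by omega⟩ : Fin d₁) ⟨i + 1, hi⟩ a) := by
      simp only [Equiv.swap_apply_def, Fin.ext_iff, Fin.val_castAdd]
      split_ifs <;> simp
    simp [swapWord, this]
  · have : Equiv.swap (⟨i, by omega⟩ : Fin (d₁ + d₂)) ⟨i + 1, hi'⟩ (Fin.natAdd d₁ a) =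
        Fin.natAdd d₁ a := by
      apply Equiv.swap_apply_of_ne_of_ne <;> simp only [ne_eq, Fin.ext_iff, Fin.val_natAdd] <;>
        omega
    simp [swapWord, this]

theorem swapWord_append_right {n d₁ d₂ : ℕ} (i : ℕ) (hi : i + 1 < d₂)
    (hi' : d₁ + i + 1 < d₁ + d₂) (w₁ : Fin d₁ → Fin n) (w₂ : Fin d₂ → Fin n) :
    swapWord (d₁ + i) hi' (Fin.append w₁ w₂) = Fin.append w₁ (swapWord i hi w₂) := by
  funext a
  refine Fin.addCases (fun a => ?_) (fun a => ?_) a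
  · have : Equiv.swap (⟨d₁ + i, by omega⟩ : Fin (d₁ + d₂)) ⟨d₁ + i + 1, hi'⟩ (Fin.castAdd d₂ a) =
        Fin.castAdd d₂ a := by
      apply Equiv.swap_apply_of_ne_of_ne <;> simp only [ne_eq, Fin.ext_iff, Fin.val_castAdd] <;>
        omega
    simp [swapWord, this]
  · have : Equiv.swap (⟨d₁ + i, by omega⟩ : Fin (d₁ + d₂)) ⟨d₁ + i + 1, hi'⟩ (Fin.natAdd d₁ a) =
        Fin.natAdd d₁ (Equiv.swap (⟨i, by omega⟩ : Fin d₂) ⟨i + 1, hi⟩ a) := by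
      simp only [Equiv.swap_apply_def, Fin.ext_iff, Fin.val_natAdd]
      split_ifs <;> simp <;> omega
    simp [swapWord, this]

theorem heckeT_concat_left (q : K) (n d₁ d₂ : ℕ) (i : ℕ) (hi : i + 1 < d₁) :
    heckeT q n (d₁ + d₂) i (by omega) ∘ₗ (concat K n d₁ d₂).toLinearMap =
      (concat K n d₁ d₂).toLinearMap ∘ₗ
        TensorProduct.map (heckeT q n d₁ i hi) LinearMap.id := by
  refine ((wordBasis K n d₁).tensorProduct (wordBasis K n d₂)).ext fun ⟨w₁, w₂⟩ => ?_
  have h1 : Fin.append w₁ w₂ ⟨i, by omega⟩ = w₁ ⟨i, by omega⟩ :=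
    Fin.append_left w₁ w₂ ⟨i, by omega⟩
  have h2 : Fin.append w₁ w₂ ⟨i + 1, by omega⟩ = w₁ ⟨i + 1, hi⟩ :=
    Fin.append_left w₁ w₂ ⟨i + 1, hi⟩
  simp only [LinearMap.comp_apply, Module.Basis.tensorProduct_apply, LinearEquiv.coe_coe,
    concat_wordBasis, heckeT, Module.Basis.constr_basis, TensorProduct.map_tmul, h1, h2,
    LinearMap.id_apply, swapWord_append_left i hi]
  split_ifs <;>
    simp only [TensorProduct.add_tmul, ← TensorProduct.smul_tmul', map_add, map_smul,
      concat_wordBasis]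

theorem heckeT_concat_right (q : K) (n d₁ d₂ : ℕ) (i : ℕ) (hi : i + 1 < d₂) :
    heckeT q n (d₁ + d₂) (d₁ + i) (by omega) ∘ₗ (concat K n d₁ d₂).toLinearMap =
      (concat K n d₁ d₂).toLinearMap ∘ₗ
        TensorProduct.map LinearMap.id (heckeT q n d₂ i hi) := by
  refine ((wordBasis K n d₁).tensorProduct (wordBasis K n d₂)).ext fun ⟨w₁, w₂⟩ => ?_
  have h1 : Fin.append w₁ w₂ ⟨d₁ + i, by omega⟩ = w₂ ⟨i, by omega⟩ :=
    Fin.append_right w₁ w₂ ⟨i, by omega⟩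
  have h2 : Fin.append w₁ w₂ ⟨d₁ + i + 1, by omega⟩ = w₂ ⟨i + 1, hi⟩ :=
    Fin.append_right w₁ w₂ ⟨i + 1, hi⟩
  simp only [LinearMap.comp_apply, Module.Basis.tensorProduct_apply, LinearEquiv.coe_coe,
    concat_wordBasis, heckeT, Module.Basis.constr_basis, TensorProduct.map_tmul, h1, h2,
    LinearMap.id_apply, swapWord_append_right i hi]
  split_ifs <;>
    simp only [TensorProduct.tmul_add, TensorProduct.tmul_smul, map_add, map_smul,
      concat_wordBasis]

theorem exists_rTensor_subtype {M N P : Type*} [AddCommGroup M] [Module K M] [AddCommGroup N]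
    [Module K N] [AddCommGroup P] [Module K P] {ι : Type*} (φ : ι → M →ₗ[K] P)
    (S : Submodule K M) (hS : ∀ x, (∀ i, φ i x = 0) → x ∈ S) (x : M ⊗[K] N)
    (hx : ∀ i, (φ i).rTensor N x = 0) : ∃ y : S ⊗[K] N, S.subtype.rTensor N y = x := by
  classical
  let b := Module.Basis.ofVectorSpace K N
  have key (i) (z : M ⊗[K] N) (j) :
      TensorProduct.equivFinsuppOfBasisRight b ((φ i).rTensor N z) j =
        φ i (TensorProduct.equivFinsuppOfBasisRight b z j) := by
    induction z with
    | zero => simp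
    | add a c ha hc => simp only [map_add, Finsupp.add_apply, ha, hc]
    | tmul m n => simp
  let e := TensorProduct.equivFinsuppOfBasisRight (M := M) b
  have hmem (j) : e x j ∈ S := hS _ fun i => by rw [← key, hx i]; simp
  refine ⟨(e x).sum fun j _ => (⟨e x j, hmem j⟩ : S) ⊗ₜ b j, ?_⟩
  rw [Finsupp.sum, map_sum]
  conv_rhs => rw [← e.symm_apply_apply x]
  rw [TensorProduct.equivFinsuppOfBasisRight_symm_apply, Finsupp.sum]
  rfl

theorem exists_lTensor_subtype {M N P : Type*} [AddCommGroup M] [Module K M] [AddCommGroup N]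
    [Module K N] [AddCommGroup P] [Module K P] {ι : Type*} (φ : ι → M →ₗ[K] P)
    (S : Submodule K M) (hS : ∀ x, (∀ i, φ i x = 0) → x ∈ S) (x : N ⊗[K] M)
    (hx : ∀ i, (φ i).lTensor N x = 0) : ∃ y : N ⊗[K] S, S.subtype.lTensor N y = x := by
  obtain ⟨y, hy⟩ := exists_rTensor_subtype φ S hS (TensorProduct.comm K N M x) fun i => by
    rw [LinearMap.rTensor, TensorProduct.map_comm, ← LinearMap.lTensor, hx i, map_zero]
  refine ⟨TensorProduct.comm K S N y, (TensorProduct.comm K N M).injective ?_⟩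
  rw [← hy, LinearMap.lTensor, TensorProduct.map_comm]
  exact (TensorProduct.comm K M N).symm_apply_apply _

/-- The map sending `f₁ ⊗ f₂` to the tensor product of the linear maps `f₁` and `f₂`. -/
def schurTensor (q : K) (n m d₁ d₂ : ℕ) :
    schur q n m d₁ ⊗[K] schur q n m d₂ →ₗ[K]
      (TensorSpace K n d₁ ⊗[K] TensorSpace K n d₂ →ₗ[K]
        TensorSpace K m d₁ ⊗[K] TensorSpace K m d₂) :=
  TensorProduct.homTensorHomMap (.id K) _ _ _ _ ∘ₗ
    TensorProduct.map (schur q n m d₁).subtype (schur q n m d₂).subtype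

@[simp]
theorem schurTensor_tmul (q : K) (n m d₁ d₂ : ℕ) (f₁ : schur q n m d₁) (f₂ : schur q n m d₂) :
    schurTensor q n m d₁ d₂ (f₁ ⊗ₜ f₂) = TensorProduct.map f₁.1 f₂.1 := rfl

theorem homTensorHomMap_injective (M N P Q : Type*) [AddCommGroup M] [Module K M]
    [AddCommGroup N] [Module K N] [AddCommGroup P] [Module K P] [AddCommGroup Q] [Module K Q]
    [Module.Finite K M] [Module.Finite K N] :
    Function.Injective (TensorProduct.homTensorHomMap (.id K) M N P Q) := by
  rw [← homTensorHomEquiv_toLinearMap]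
  exact (homTensorHomEquiv K M N P Q).injective

theorem schurTensor_injective (q : K) (n m d₁ d₂ : ℕ) :
    Function.Injective (schurTensor q n m d₁ d₂) :=
  (homTensorHomMap_injective _ _ _ _).comp
    (TensorProduct.map_injective_of_flat_flat _ _ (Submodule.subtype_injective _)
      (Submodule.subtype_injective _))

/-- A map that is linear over the product of two Hecke algebras is a sum of tensor products of
Hecke linear maps. -/
theorem mem_range_schurTensor (q : K) (n m d₁ d₂ : ℕ)
    (g : TensorSpace K n d₁ ⊗[K] TensorSpace K n d₂ →ₗ[K]
      TensorSpace K m d₁ ⊗[K] TensorSpace K m d₂)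
    (h₁ : ∀ (i : ℕ) (hi : i + 1 < d₁),
      g ∘ₗ TensorProduct.map (heckeT q n d₁ i hi) LinearMap.id =
        TensorProduct.map (heckeT q m d₁ i hi) LinearMap.id ∘ₗ g)
    (h₂ : ∀ (i : ℕ) (hi : i + 1 < d₂),
      g ∘ₗ TensorProduct.map LinearMap.id (heckeT q n d₂ i hi) =
        TensorProduct.map LinearMap.id (heckeT q m d₂ i hi) ∘ₗ g) :
    g ∈ LinearMap.range (schurTensor q n m d₁ d₂) := by
  let φ (d : ℕ) (i : {i : ℕ // i + 1 < d}) :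
      (TensorSpace K n d →ₗ[K] TensorSpace K m d) →ₗ[K]
        (TensorSpace K n d →ₗ[K] TensorSpace K m d) :=
    LinearMap.lcomp K _ (heckeT q n d i.1 i.2) - LinearMap.llcomp K _ _ _ (heckeT q m d i.1 i.2)
  have hφ (d : ℕ) (f) (hf : ∀ i, φ d i f = 0) : f ∈ schur q n m d := by
    intro i hi
    exact sub_eq_zero.1 (hf ⟨i, hi⟩)
  let H := TensorProduct.homTensorHomMap (.id K) (TensorSpace K n d₁) (TensorSpace K n d₂)
    (TensorSpace K m d₁) (TensorSpace K m d₂)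
  have hH : Function.Injective H := homTensorHomMap_injective _ _ _ _
  obtain ⟨x, rfl⟩ : ∃ x, H x = g :=
    ⟨(homTensorHomEquiv K _ _ _ _).symm g, by
      rw [← homTensorHomEquiv_apply, LinearEquiv.apply_symm_apply]⟩
  have k₁ (i) (z) : H ((φ d₁ i).rTensor _ z) =
      H z ∘ₗ TensorProduct.map (heckeT q n d₁ i.1 i.2) LinearMap.id -
        TensorProduct.map (heckeT q m d₁ i.1 i.2) LinearMap.id ∘ₗ H z := by
    induction z with
    | zero => simp
    | add a b ha hb =>
      rw [map_add, map_add, ha, hb, map_add, LinearMap.add_comp, LinearMap.comp_add]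
      abel
    | tmul a b =>
      refine TensorProduct.ext' fun v w => ?_
      simp [H, φ]
  have k₂ (i) (z) : H ((φ d₂ i).lTensor _ z) =
      H z ∘ₗ TensorProduct.map LinearMap.id (heckeT q n d₂ i.1 i.2) -
        TensorProduct.map LinearMap.id (heckeT q m d₂ i.1 i.2) ∘ₗ H z := by
    induction z with
    | zero => simp
    | add a b ha hb =>
      rw [map_add, map_add, ha, hb, map_add, LinearMap.add_comp, LinearMap.comp_add]
      abel
    | tmul a b =>
      refine TensorProduct.ext' fun v w => ?_
      simp [H, φ]
  obtain ⟨y, rfl⟩ := exists_rTensor_subtype (φ d₁) (schur q n m d₁) (hφ d₁) x fun i => by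
    apply hH
    rw [k₁, map_zero, h₁, sub_self]
  obtain ⟨z, rfl⟩ := exists_lTensor_subtype (φ d₂) (schur q n m d₂) (hφ d₂) y fun i => by
    apply Module.Flat.rTensor_preserves_injective_linearMap (schur q n m d₁).subtype
      (Submodule.subtype_injective _)
    apply hH
    have : (schur q n m d₁).subtype.rTensor _ ((φ d₂ i).lTensor _ y) =
        (φ d₂ i).lTensor _ ((schur q n m d₁).subtype.rTensor _ y) := by
      rw [← LinearMap.comp_apply, ← LinearMap.comp_apply, LinearMap.rTensor_comp_lTensor,
        LinearMap.lTensor_comp_rTensor]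
    rw [this, k₂, map_zero, map_zero, h₂, sub_self]
  refine ⟨z, ?_⟩
  exact congrArg H (LinearMap.congr_fun (LinearMap.rTensor_comp_lTensor _ _ _) z).symm

theorem concat_conj_mem_range (q : K) (n m d₁ d₂ : ℕ) (f : schur q n m (d₁ + d₂)) :
    (concat K m d₁ d₂).symm.toLinearMap ∘ₗ f.1 ∘ₗ (concat K n d₁ d₂).toLinearMap ∈
      LinearMap.range (schurTensor q n m d₁ d₂) := by
  apply mem_range_schurTensor
  · intro i hi
    refine LinearMap.ext fun x => (concat K m d₁ d₂).injective ?_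
    have e₁ (y) := LinearMap.congr_fun (heckeT_concat_left q n d₁ d₂ i hi) y
    have e₂ (y) := LinearMap.congr_fun (heckeT_concat_left q m d₁ d₂ i hi) y
    have e₃ (y) := LinearMap.congr_fun (f.2 i (by omega)) y
    simp only [LinearMap.comp_apply, LinearEquiv.coe_coe] at e₁ e₂ e₃ ⊢
    rw [LinearEquiv.apply_symm_apply, ← e₁, e₃, ← e₂, LinearEquiv.apply_symm_apply]
  · intro i hi
    refine LinearMap.ext fun x => (concat K m d₁ d₂).injective ?_
    have e₁ (y) := LinearMap.congr_fun (heckeT_concat_right q n d₁ d₂ i hi) y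
    have e₂ (y) := LinearMap.congr_fun (heckeT_concat_right q m d₁ d₂ i hi) y
    have e₃ (y) := LinearMap.congr_fun (f.2 (d₁ + i) (by omega)) y
    simp only [LinearMap.comp_apply, LinearEquiv.coe_coe] at e₁ e₂ e₃ ⊢
    rw [LinearEquiv.apply_symm_apply, ← e₁, e₃, ← e₂, LinearEquiv.apply_symm_apply]

/-- The comultiplication `Δ : S_q(n, m; d₁ + d₂) → S_q(n, m; d₁) ⊗ S_q(n, m; d₂)`. It sends `f`
to the unique `∑ f₁ ⊗ f₂` that equals `f` as a linear map
`V_n^{⊗ d₁} ⊗ V_n^{⊗ d₂} → V_m^{⊗ d₁} ⊗ V_m^{⊗ d₂}`. -/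
def schurComul (q : K) (n m d₁ d₂ : ℕ) :
    schur q n m (d₁ + d₂) →ₗ[K] schur q n m d₁ ⊗[K] schur q n m d₂ :=
  (LinearEquiv.ofInjective (schurTensor q n m d₁ d₂)
      (schurTensor_injective q n m d₁ d₂)).symm.toLinearMap ∘ₗ
    LinearMap.codRestrict _
      (LinearMap.llcomp K _ _ _ (concat K m d₁ d₂).symm.toLinearMap ∘ₗ
        LinearMap.lcomp K _ (concat K n d₁ d₂).toLinearMap ∘ₗ (schur q n m (d₁ + d₂)).subtype)
      (concat_conj_mem_range q n m d₁ d₂)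

theorem schurTensor_schurComul (q : K) (n m d₁ d₂ : ℕ) (f : schur q n m (d₁ + d₂)) :
    schurTensor q n m d₁ d₂ (schurComul q n m d₁ d₂ f) =
      (concat K m d₁ d₂).symm.toLinearMap ∘ₗ f.1 ∘ₗ (concat K n d₁ d₂).toLinearMap :=
  congrArg Subtype.val (LinearEquiv.apply_symm_apply
    (LinearEquiv.ofInjective (schurTensor q n m d₁ d₂) (schurTensor_injective q n m d₁ d₂)) _)

end Hecke

/-! ### The source categories and homogeneous quantum polynomial functors -/

/-- The objects `V_n^{⊗ d}`, `n ≥ 1`, of the source category of degree `d`. -/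
structure Source {K : Type u} [Field K] (q : K) (d : ℕ) where
  /-- The number `n ≥ 1`. -/
  rank : ℕ+

section Functors

variable {K : Type u} [Field K] {q : K}

instance (d : ℕ) : Category.{u} (Source q d) where
  Hom X Y := schur q X.rank Y.rank d
  id X := schurId q X.rank d
  comp f g := schurComp g f
  id_comp _ := rfl
  comp_id _ := rfl
  assoc _ _ _ := rfl

instance (d : ℕ) : Preadditive (Source q d) where
  homGroup X Y := inferInstanceAs (AddCommGroup (schur q X.rank Y.rank d))
  add_comp _ _ _ f f' g := Subtype.ext (LinearMap.comp_add f.1 f'.1 g.1)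
  comp_add _ _ _ f g g' := Subtype.ext (LinearMap.add_comp f.1 g'.1 g.1)

instance (d : ℕ) : CategoryTheory.Linear K (Source q d) where
  homModule X Y := inferInstanceAs (Module K (schur q X.rank Y.rank d))
  smul_comp _ _ _ c f g := Subtype.ext (LinearMap.comp_smul g.1 c f.1)
  comp_smul _ _ _ f c g := Subtype.ext (LinearMap.smul_comp c g.1 f.1)

/-- A functor from the source category of degree `d` to finite dimensional vector spaces is
`K`-linear. -/
def IsKLinear {d : ℕ} (F : Source q d ⥤ FGModuleCat.{u} K) : Prop :=
  F.Additive ∧ F.Linear K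

variable (q) in
/-- The category of homogeneous quantum polynomial functors of degree `d` : the `K`-linear
functors from the source category of degree `d` to finite dimensional vector spaces. -/
abbrev HomogFunctor (d : ℕ) : Type (u + 1) :=
  ObjectProperty.FullSubcategory (C := Source q d ⥤ FGModuleCat.{u} K) IsKLinear

/-- The value `F(n)`, for `n ≥ 1`. -/
abbrev HomogFunctor.val {d : ℕ} (F : HomogFunctor q d) (n : ℕ+) : Type u :=
  F.obj.obj (⟨n⟩ : Source q d)

/-- The action of `S_q(n, m; d)` on the values of `F`. -/
def HomogFunctor.act {d : ℕ} (F : HomogFunctor q d) (n m : ℕ+) :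
    schur q n m d →ₗ[K] F.val n →ₗ[K] F.val m where
  toFun f := (F.obj.map (X := ⟨n⟩) (Y := ⟨m⟩) f).hom.hom
  map_add' f g := by
    have := F.property.1
    have h := F.obj.map_add (X := ⟨n⟩) (Y := ⟨m⟩) (f := f) (g := g)
    exact congrArg (fun φ => φ.hom.hom) h
  map_smul' c f := by
    have := F.property.2
    have h := Functor.Linear.map_smul (F := F.obj) (R := K) (X := ⟨n⟩) (Y := ⟨m⟩) f c
    exact congrArg (fun φ => φ.hom.hom) h

/-! ### The category of quantum polynomial functors -/

variable (q) in
/-- The disjoint union over `d ≥ 0` of the source categories of degree `d`. A functor on it is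
a family, indexed by `d`, of functors on the source categories of degree `d`, and a morphism of
functors is a family of morphisms. -/
abbrev TotalSource : Type := Σ d : ℕ, Source q d

variable (q) in
/-- Such a family belongs to the direct sum over `d ≥ 0` of the categories of homogeneous
quantum polynomial functors of degree `d` : each component is `K`-linear, and all but finitely
many components are zero. -/
def IsQuantumPolynomial : ObjectProperty (TotalSource q ⥤ FGModuleCat.{u} K) := fun F =>
  (∀ d : ℕ, IsKLinear (Sigma.incl d ⋙ F)) ∧
    {d : ℕ | ¬ ∀ X : Source q d, IsZero (F.obj ⟨d, X⟩)}.Finite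

variable (q) in
/-- The category of quantum polynomial functors, the direct sum over `d ≥ 0` of the categories
of homogeneous quantum polynomial functors of degree `d`. -/
abbrev QPFunctor : Type (u + 1) := (IsQuantumPolynomial q).FullSubcategory

/-- The homogeneous component of degree `d`. -/
def QPFunctor.component (A : QPFunctor q) (d : ℕ) : HomogFunctor q d :=
  ⟨Sigma.incl d ⋙ A.obj, A.property.1 d⟩

/-- `α` is a weight of the homogeneous functor `F` of degree `d` : the weight space
`F(n)_α = ξ_α F(n)` is nonzero. (If the sum of `α` is not `d`, then `ξ_α = 0`.) -/
def HomogFunctor.IsWeight {d : ℕ} (F : HomogFunctor q d) (n : ℕ+) (α : Fin n → ℕ) : Prop :=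
  LinearMap.range (F.act n n (xi q n d α)) ≠ ⊥

/-- The composition `α` of length `n` is a weight of the quantum polynomial functor `A`. -/
def QPFunctor.IsWeight (A : QPFunctor q) (n : ℕ+) (α : Fin n → ℕ) : Prop :=
  ∃ d : ℕ, (A.component d).IsWeight n α

theorem isKLinear_of_jointly_mono {d : ℕ} {ι : Type*} {F : Source q d ⥤ FGModuleCat.{u} K}
    {G : ι → Source q d ⥤ FGModuleCat.{u} K} (f : ∀ j, F ⟶ G j)
    (hf : ∀ (X Y : Source q d) (a b : F.obj X ⟶ F.obj Y),
      (∀ j, a ≫ (f j).app Y = b ≫ (f j).app Y) → a = b)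
    (hG : ∀ j, IsKLinear (G j)) : IsKLinear F := by
  refine ⟨⟨?_⟩, ⟨?_⟩⟩
  · intro X Y a b
    refine hf X Y _ _ fun j => ?_
    have := (hG j).1
    simp [Functor.map_add, Preadditive.comp_add, Preadditive.add_comp]
  · intro X Y a c
    refine hf X Y _ _ fun j => ?_
    have := (hG j).2
    simp [Functor.map_smul]

theorem isKLinear_of_epi {d : ℕ} {F G : Source q d ⥤ FGModuleCat.{u} K} (f : F ⟶ G)
    [∀ X, Epi (f.app X)] (hF : IsKLinear F) : IsKLinear G := by
  have := hF.1
  have := hF.2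
  refine ⟨⟨?_⟩, ⟨?_⟩⟩
  · intro X Y a b
    rw [← cancel_epi (f.app X)]
    simp [← NatTrans.naturality, Functor.map_add, Preadditive.comp_add, Preadditive.add_comp]
  · intro X Y a c
    rw [← cancel_epi (f.app X)]
    simp [← NatTrans.naturality, Functor.map_smul]

instance : (IsQuantumPolynomial q).IsClosedUnderSubobjects where
  prop_of_mono {F G} f _ hG := by
    refine ⟨fun d => ?_, hG.2.subset ?_⟩
    · exact isKLinear_of_jointly_mono (ι := Unit) (fun _ => Functor.whiskerLeft (Sigma.incl d) f)
        (fun X Y a b h => (cancel_mono (f.app ⟨d, Y⟩)).1 (h ())) fun _ => hG.1 d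
    · intro d hd h
      exact hd fun X => IsZero.of_mono (f.app _) (h X)

instance : (IsQuantumPolynomial q).IsClosedUnderQuotients where
  prop_of_epi {F G} f _ hF := by
    refine ⟨fun d => ?_, hF.2.subset ?_⟩
    · have : ∀ X, Epi ((Functor.whiskerLeft (Sigma.incl d) f).app X) := fun X =>
        inferInstanceAs (Epi (f.app _))
      exact isKLinear_of_epi (Functor.whiskerLeft (Sigma.incl d) f) (hF.1 d)
    · intro d hd h
      exact hd fun X => IsZero.of_epi (f.app _) (h X)

theorem isKLinear_of_forall_isZero {d : ℕ} {F : Source q d ⥤ FGModuleCat.{u} K}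
    (h : ∀ X, IsZero (F.obj X)) : IsKLinear F :=
  ⟨⟨fun {_ Y _ _} => (h Y).eq_of_tgt _ _⟩, ⟨fun {_ Y} _ _ => (h Y).eq_of_tgt _ _⟩⟩

instance : (IsQuantumPolynomial q).ContainsZero where
  exists_zero := by
    refine ⟨_, isZero_zero (TotalSource q ⥤ FGModuleCat.{u} K), ?_⟩
    have h := fun X => ((isZero_zero (TotalSource q ⥤ FGModuleCat.{u} K)).obj X)
    refine ⟨fun d => isKLinear_of_forall_isZero fun X => h _, ?_⟩
    refine Set.finite_empty.subset ?_
    intro d hd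
    exact hd fun X => h _

instance : (IsQuantumPolynomial q).IsClosedUnderBinaryProducts where
  limitsOfShape_le := by
    rintro F ⟨p⟩
    have hl : ∀ X, IsLimit (((evaluation _ _).obj X).mapCone p.cone) := fun X =>
      isLimitOfPreserves ((evaluation _ _).obj X) p.isLimit
    have hj := p.prop_diag_obj
    refine ⟨fun d => ?_, ?_⟩
    · exact isKLinear_of_jointly_mono (fun j => Functor.whiskerLeft (Sigma.incl d) (p.π.app j))
        (fun X Y a b h => (hl ⟨d, Y⟩).hom_ext h) fun j => (hj j).1 d
    · refine ((hj ⟨.left⟩).2.union (hj ⟨.right⟩).2).subset ?_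
      intro d hd
      by_contra hc
      simp only [Set.mem_union, Set.mem_ofPred_eq, not_or, not_not] at hc
      refine hd fun X => ?_
      rw [IsZero.iff_id_eq_zero]
      refine (hl ⟨d, X⟩).hom_ext fun j => ?_
      rcases j with ⟨_ | _⟩
      · exact (hc.1 X).eq_of_tgt _ _
      · exact (hc.2 X).eq_of_tgt _ _

instance : (IsQuantumPolynomial q).IsClosedUnderFiniteProducts :=
  ObjectProperty.IsClosedUnderFiniteProducts.mk'

instance : Abelian (QPFunctor q) := inferInstance

instance : HasExt.{u + 1} (QPFunctor q) := HasExt.standard _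

/-! ### Tensor products and homogeneous functors -/

theorem HomogFunctor.act_id {d : ℕ} (F : HomogFunctor q d) (n : ℕ+) :
    F.act n n (schurId q n d) = LinearMap.id :=
  congrArg (fun φ => φ.hom.hom) (F.obj.map_id ⟨n⟩)

theorem HomogFunctor.act_comp {d : ℕ} (F : HomogFunctor q d) (n r m : ℕ+)
    (g : schur q r m d) (f : schur q n r d) :
    F.act n m (schurComp g f) = F.act r m g ∘ₗ F.act n r f :=
  congrArg (fun φ => φ.hom.hom) (F.obj.map_comp (X := ⟨n⟩) (Y := ⟨r⟩) (Z := ⟨m⟩) f g)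

/-- The map sending `f₁ ⊗ f₂` to `F(f₁) ⊗ G(f₂)`. -/
def tensorAct {d₁ d₂ : ℕ} (F : HomogFunctor q d₁) (G : HomogFunctor q d₂) (n m : ℕ+) :
    schur q n m d₁ ⊗[K] schur q n m d₂ →ₗ[K]
      (F.val n ⊗[K] G.val n →ₗ[K] F.val m ⊗[K] G.val m) :=
  TensorProduct.homTensorHomMap (.id K) _ _ _ _ ∘ₗ TensorProduct.map (F.act n m) (G.act n m)

@[simp]
theorem tensorAct_tmul {d₁ d₂ : ℕ} (F : HomogFunctor q d₁) (G : HomogFunctor q d₂) (n m : ℕ+)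
    (f₁ : schur q n m d₁) (f₂ : schur q n m d₂) :
    tensorAct F G n m (f₁ ⊗ₜ f₂) = TensorProduct.map (F.act n m f₁) (G.act n m f₂) := rfl

theorem tensorAct_schurId {d₁ d₂ : ℕ} (F : HomogFunctor q d₁) (G : HomogFunctor q d₂) (n : ℕ+) :
    tensorAct F G n n (schurComul q n n d₁ d₂ (schurId q n (d₁ + d₂))) = LinearMap.id := by
  have : schurComul q n n d₁ d₂ (schurId q n (d₁ + d₂)) =
      schurId q n d₁ ⊗ₜ schurId q n d₂ := by
    apply schurTensor_injective
    rw [schurTensor_schurComul]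
    refine TensorProduct.ext' fun x y => ?_
    simp [schurId]
  rw [this, tensorAct_tmul, F.act_id, G.act_id, TensorProduct.map_id]

theorem exists_schurTensor_comp {d₁ d₂ : ℕ} (F : HomogFunctor q d₁) (G : HomogFunctor q d₂)
    (n r m : ℕ+) (y : schur q r m d₁ ⊗[K] schur q r m d₂)
    (x : schur q n r d₁ ⊗[K] schur q n r d₂) :
    ∃ z, schurTensor q n m d₁ d₂ z = schurTensor q r m d₁ d₂ y ∘ₗ schurTensor q n r d₁ d₂ x ∧
      tensorAct F G n m z = tensorAct F G r m y ∘ₗ tensorAct F G n r x := by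
  induction y with
  | zero => exact ⟨0, by simp, by simp⟩
  | add y y' hy hy' =>
    obtain ⟨z, h₁, h₂⟩ := hy
    obtain ⟨z', h₁', h₂'⟩ := hy'
    exact ⟨z + z', by rw [map_add, map_add, h₁, h₁', LinearMap.add_comp],
      by rw [map_add, map_add, h₂, h₂', LinearMap.add_comp]⟩
  | tmul g₁ g₂ =>
    induction x with
    | zero => exact ⟨0, by simp, by simp⟩
    | add x x' hx hx' =>
      obtain ⟨z, h₁, h₂⟩ := hx
      obtain ⟨z', h₁', h₂'⟩ := hx'
      exact ⟨z + z', by rw [map_add, map_add, h₁, h₁', LinearMap.comp_add],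
        by rw [map_add, map_add, h₂, h₂', LinearMap.comp_add]⟩
    | tmul f₁ f₂ =>
      refine ⟨schurComp g₁ f₁ ⊗ₜ schurComp g₂ f₂, ?_, ?_⟩
      · simp only [schurTensor_tmul, schurComp, TensorProduct.map_comp]
      · simp only [tensorAct_tmul, HomogFunctor.act_comp, TensorProduct.map_comp]

theorem tensorAct_schurComp {d₁ d₂ : ℕ} (F : HomogFunctor q d₁) (G : HomogFunctor q d₂)
    (n r m : ℕ+) (g : schur q r m (d₁ + d₂)) (f : schur q n r (d₁ + d₂)) :
    tensorAct F G n m (schurComul q n m d₁ d₂ (schurComp g f)) =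
      tensorAct F G r m (schurComul q r m d₁ d₂ g) ∘ₗ
        tensorAct F G n r (schurComul q n r d₁ d₂ f) := by
  obtain ⟨z, h₁, h₂⟩ := exists_schurTensor_comp F G n r m
    (schurComul q r m d₁ d₂ g) (schurComul q n r d₁ d₂ f)
  have : schurComul q n m d₁ d₂ (schurComp g f) = z := by
    apply schurTensor_injective
    rw [h₁, schurTensor_schurComul, schurTensor_schurComul, schurTensor_schurComul]
    refine LinearMap.ext fun x => ?_
    simp [schurComp]
  rw [this, h₂]

/-- The tensor product `F ⊗ G` of homogeneous quantum polynomial functors: its value at `n` is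
`F(n) ⊗ G(n)`, and `(F ⊗ G)(f) = ∑ F(f₁) ⊗ G(f₂)` where `Δ(f) = ∑ f₁ ⊗ f₂`. -/
def HomogFunctor.tensor {d₁ d₂ : ℕ} (F : HomogFunctor q d₁) (G : HomogFunctor q d₂) :
    HomogFunctor q (d₁ + d₂) where
  obj :=
    { obj := fun X => FGModuleCat.of K (F.val X.rank ⊗[K] G.val X.rank)
      map := fun {X Y} f => FGModuleCat.ofHom
        (tensorAct F G X.rank Y.rank (schurComul q X.rank Y.rank d₁ d₂ f))
      map_id := fun X => FGModuleCat.hom_ext (tensorAct_schurId F G X.rank)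
      map_comp := fun {X Y Z} f g =>
        FGModuleCat.hom_ext (tensorAct_schurComp F G X.rank Y.rank Z.rank g f) }
  property := by
    refine ⟨⟨fun {X Y f g} => FGModuleCat.hom_ext ?_⟩, ⟨fun {X Y} f c => FGModuleCat.hom_ext ?_⟩⟩
    · exact (congrArg (tensorAct F G X.rank Y.rank)
        ((schurComul q X.rank Y.rank d₁ d₂).map_add f g)).trans (map_add _ _ _)
    · exact (congrArg (tensorAct F G X.rank Y.rank)
        ((schurComul q X.rank Y.rank d₁ d₂).map_smul c f)).trans (map_smul _ _ _)

/-- The sum `d_0 + (d_1 + (⋯ + d_k))`. -/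
def totalDegree : (k : ℕ) → (Fin (k + 1) → ℕ) → ℕ
  | 0, d => d 0
  | k + 1, d => d 0 + totalDegree k fun i => d i.succ

/-- The tensor product `F_0 ⊗ (F_1 ⊗ (⋯ ⊗ F_k))`. -/
def tensorAll : (k : ℕ) → (d : Fin (k + 1) → ℕ) → ((i : Fin (k + 1)) → HomogFunctor q (d i)) →
    HomogFunctor q (totalDegree k d)
  | 0, _, F => F 0
  | k + 1, d, F => (F 0).tensor (tensorAll k (fun i => d i.succ) fun i => F i.succ)

/-- A homogeneous functor of degree `d` as a quantum polynomial functor: its component of degree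
`d` is `F`, and its other components are zero. -/
def HomogFunctor.toQP {d : ℕ} (F : HomogFunctor q d) : QPFunctor q where
  obj := Sigma.desc
    (Function.update (fun e => (Functor.const (Source q e)).obj (FGModuleCat.of K PUnit.{u + 1}))
      d F.obj)
  property := by
    have hz : IsZero (FGModuleCat.of K PUnit.{u + 1}) := by
      rw [IsZero.iff_id_eq_zero]
      exact FGModuleCat.hom_ext (LinearMap.ext fun _ => rfl)
    refine ⟨fun e => ?_, (Set.finite_singleton d).subset ?_⟩
    · change IsKLinear (Function.update (fun e => (Functor.const (Source q e)).obj
        (FGModuleCat.of K PUnit.{u + 1})) d F.obj e)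
      by_cases h : e = d
      · subst h
        rw [Function.update_self]
        exact F.property
      · rw [Function.update_of_ne h]
        exact isKLinear_of_forall_isZero fun _ => hz
    · intro e he
      by_contra h
      refine he fun X => ?_
      change IsZero ((Function.update (fun e => (Functor.const (Source q e)).obj
        (FGModuleCat.of K PUnit.{u + 1})) d F.obj e).obj X)
      rw [Function.update_of_ne h]
      exact hz

end Functors

end QuantumFunctor

end

/-! Put b = k + 1. Replacing V_n by the sum V_{bn} of b copies of V_n is an endofunctor of each C_d
(`blowUpFunctor`). Precomposition with it is an exact endofunctor T of P_q, with (TA)(n) = A(bn).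
The proof compares T with the identity.

The letters of V_{bn} are pairs (block, value), compared by block first. As a Hecke module,
V_{bn}^{⊗d} is a sum of coinduced modules. A Hecke linear map into it is the same as a family of
components, one for each weakly increasing word β of blocks, where the component at β need only
commute with those T_i for which β_i = β_{i+1} (`lift` for existence, `schur_ext_of_noDescent` for
uniqueness). This yields the action of T on morphisms. For the word β = 0⋯01⋯1⋯k⋯k, with letter i
occurring d_i times, it also yields a map `diag` from V_n^{⊗d} to V_{bn}^{⊗d} whose component is the
identity at β and zero at the other increasing words. It is natural in n, so it gives a natural
transformation η from the identity to T.

If the weights of A have at most k non-zero parts, then η_A = 0. The image of `diag` lies in the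
span of words in which all k + 1 blocks occur, and every ξ_α with at most k non-zero parts kills
these (`xi_diag_eq_zero`).

If Y is the tensor product of the F_i, then η_Y has a left inverse ρ. The projection of V_{bn}^{⊗d}
to its component at β is linear only over H_{d_0} ⊗ ⋯ ⊗ H_{d_k}, but the action on a tensor product
is defined by splitting a map into tensor factors, for which this linearity suffices
(`tensorAllExtension`, `exists_retraction_homog`).

Since T is exact and η_A = 0, composing any class of Ext^s(A, Y) with η_Y gives zero
(`comp_mk₀_app_eq_zero`). As ρ η_Y = 1, the class itself is zero. -/

noncomputable section

/-! ### Natural transformations to an exact endofunctor, and their effect on Ext. -/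

section Effaceable

universe w v u'

variable {C : Type u'} [Category.{v} C] [Abelian C]

/-- In its degree, a quasi-isomorphism from a complex concentrated in one degree is a
monomorphism. -/
theorem CochainComplex.mono_f_of_quasiIsoAt_single
    {Y : C} {L : CochainComplex C ℤ} {i : ℤ}
    (ι : (HomologicalComplex.single C (.up ℤ) i).obj Y ⟶ L) (h : QuasiIsoAt ι i) :
    Mono (ι.f i) := by
  -- Followed by the projection to opcycles, `ι.f i` becomes an isomorphism followed by H^i(ι),
  -- which is invertible, and by the monomorphism from homology to opcycles.
  have h' : ι.f i ≫ L.pOpcycles i =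
      (HomologicalComplex.singleObjXSelf (.up ℤ) i Y).hom ≫
        (HomologicalComplex.singleObjHomologySelfIso (.up ℤ) i Y).inv ≫
          HomologicalComplex.homologyMap ι i ≫ L.homologyι i := by
    rw [HomologicalComplex.homologyι_naturality,
      HomologicalComplex.singleObjHomologySelfIso_inv_homologyι_assoc,
      ← HomologicalComplex.pOpcycles_singleObjOpcyclesSelfIso_inv_assoc, Iso.inv_hom_id_assoc,
      HomologicalComplex.p_opcyclesMap]
  have : Mono (ι.f i ≫ L.pOpcycles i) := by
    rw [h']
    infer_instance
  exact mono_of_mono _ (L.pOpcycles i)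

/-- Write φ as a fraction K → L ← Y with L zero below degree i. Then E = L^i works: Y → L^i is mono
because the denominator is a quasi-isomorphism, L maps onto its lowest term L^i by a chain map, and
K → L → L^i is zero because K^i = 0. -/
theorem DerivedCategory.exists_mono_comp_singleFunctor_map_eq_zero [HasDerivedCategory.{w} C]
    {Y : C} {K : CochainComplex C ℤ} {i : ℤ}
    (φ : Q.obj K ⟶ Q.obj ((CochainComplex.singleFunctor C i).obj Y))
    (n : ℤ) (hn : i < n) [K.IsStrictlyGE n] :
    ∃ (E : C) (j : Y ⟶ E), Mono j ∧ φ ≫ Q.map ((CochainComplex.singleFunctor C i).map j) = 0 := by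
  obtain ⟨L, _, g, ι, h, rfl⟩ := left_fac_of_isStrictlyGE φ i
  have h' : QuasiIsoAt ι i := by
    rw [isIso_Q_map_iff_quasiIso] at h
    exact h.quasiIsoAt i
  have := CochainComplex.mono_f_of_quasiIsoAt_single (i := i) (Y := Y) ι h'
  let ψ : L ⟶ (CochainComplex.singleFunctor C i).obj (L.X i) :=
    HomologicalComplex.mkHomToSingle (𝟙 _) (by
      rintro j hj
      apply (L.isZero_of_isStrictlyGE i j (by simp at hj; lia)).eq_of_src)
  obtain ⟨j, hj⟩ := (CochainComplex.singleFunctor C i).map_surjective (ι ≫ ψ)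
  refine ⟨L.X i, j, ?_, ?_⟩
  · have h₁ := congrArg (fun f => f.f i) hj
    dsimp only [HomologicalComplex.comp_f] at h₁
    erw [HomologicalComplex.single_map_f_self, HomologicalComplex.mkHomToSingle_f] at h₁
    have aux {A B E F : C} (a : A ≅ B) (f : B ⟶ E) (c : E ≅ F) (g : A ⟶ E) (hg : Mono g)
        (h : a.hom ≫ f ≫ c.hom = g ≫ 𝟙 E ≫ c.hom) : Mono f := by
      rw [Category.id_comp, ← Category.assoc, cancel_mono, ← Iso.eq_inv_comp] at h
      rw [h]
      infer_instance
    exact aux _ _ (HomologicalComplex.singleObjXSelf (.up ℤ) i (L.X i)).symm _ this h₁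
  · have h₂ : g ≫ ψ = 0 := by
      apply HomologicalComplex.to_single_hom_ext
      apply (K.isZero_of_isStrictlyGE n i hn).eq_of_src
    rw [hj, Q.map_comp, Category.assoc, IsIso.inv_hom_id_assoc, ← Q.map_comp, h₂, Q.map_zero]

open DerivedCategory

namespace CategoryTheory.Abelian.Ext

variable [HasExt.{w} C]

/-- Classes of positive degree are effaceable in the second variable. -/
theorem exists_mono_comp_mk₀_eq_zero {X Y : C} {n : ℕ} (e : Ext X Y (n + 1)) :
    ∃ (E : C) (j : Y ⟶ E), Mono j ∧ e.comp (mk₀ j) (add_zero (n + 1)) = 0 := by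
  let K := (CochainComplex.singleFunctor C 0).obj X
  have := K.isStrictlyGE_of_ge (-n) 0 (by lia)
  let := HasDerivedCategory.standard C
  -- The shift by n + 1 is undone by placing Y in degree -(n + 1), strictly below the bound -n for
  -- the complex of X.
  obtain ⟨E, j, hj, h⟩ := exists_mono_comp_singleFunctor_map_eq_zero (K := K) (Y := Y)
    (i := -(n + 1)) (e.hom ≫ ((singleFunctors C).shiftIso (n + 1) (-(n + 1)) 0
    (by lia)).hom.app _) (-n) (by lia)
  refine ⟨E, j, hj, ?_⟩
  apply homEquiv.injective
  simp only [← cancel_mono (((singleFunctors C).shiftIso (n + 1) (-(n + 1)) 0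
    (by lia)).hom.app _), zero_hom, Limits.zero_comp]
  change (e.comp (mk₀ j) _).hom ≫ _ = _
  rw [comp_hom, mk₀_hom, ShiftedHom.comp_mk₀]
  have := ((singleFunctors C).shiftIso (n + 1) (-(n + 1)) 0 (by lia)).hom.naturality j
  refine Eq.trans ?_ h
  exact (Category.assoc _ _ _).trans
    ((congrArg (fun x => e.hom ≫ x) this).trans (Category.assoc _ _ _).symm)

/-- If a natural transformation `η` from the identity to an exact endofunctor vanishes at `A`,
then so does the map that it induces on `Ext` groups out of `A`. -/
theorem comp_mk₀_app_eq_zero (T : C ⥤ C) [T.PreservesZeroMorphisms]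
    (hT : ∀ S : ShortComplex C, S.ShortExact → (S.map T).ShortExact) (η : ∀ X, X ⟶ T.obj X)
    (hη : ∀ {X Y : C} (f : X ⟶ Y), f ≫ η Y = η X ≫ T.map f) {A : C} (hA : η A = 0) (n : ℕ)
    {Y : C} (e : Ext A Y n) : e.comp (mk₀ (η Y)) (add_zero n) = 0 := by
  induction n generalizing Y with
  | zero =>
    obtain ⟨f, rfl⟩ := (mk₀_bijective A Y).2 e
    rw [mk₀_comp_mk₀, hη, hA, Limits.zero_comp, mk₀_zero]
  | succ n ih =>
    -- Dimension shifting: effacing e along j writes it as a class of degree n with values in the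
    -- cokernel of j, followed by the class of the extension. By `key`, η passes through that
    -- extension class, and the induction hypothesis then applies to the cokernel.
    obtain ⟨E, j, hj, h⟩ := exists_mono_comp_mk₀_eq_zero e
    let S : ShortComplex C := ShortComplex.mk j (cokernel.π j) (cokernel.condition j)
    have hS : S.ShortExact := ⟨ShortComplex.exact_cokernel j⟩
    obtain ⟨e', rfl⟩ := covariant_sequence_exact₁ A hS e h rfl
    let φ : S ⟶ S.map T :=
      { τ₁ := η _
        τ₂ := η _
        τ₃ := η _
        comm₁₂ := (hη S.f).symm
        comm₂₃ := (hη S.g).symm }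
    have key : hS.extClass.comp (mk₀ (η Y)) (add_zero 1) =
        (mk₀ (η S.X₃)).comp (hT S hS).extClass (zero_add 1) :=
      ShortComplex.ShortExact.extClass_naturality hS (hT S hS) φ
    rw [comp_assoc_of_third_deg_zero]
    refine (congrArg (fun x => e'.comp x rfl) key).trans ?_
    refine (comp_assoc_of_second_deg_zero e' (mk₀ (η S.X₃)) (hT S hS).extClass rfl).symm.trans ?_
    exact (congrArg (fun x => x.comp (hT S hS).extClass rfl) (ih e')).trans (zero_comp ..)

/-- Each class e equals (e ∘ η_Y) ∘ ρ, and e ∘ η_Y vanishes. The retraction is needed at the single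
object Y only. -/
theorem subsingleton_of_retraction (T : C ⥤ C) [T.PreservesZeroMorphisms]
    (hT : ∀ S : ShortComplex C, S.ShortExact → (S.map T).ShortExact) (η : ∀ X, X ⟶ T.obj X)
    (hη : ∀ {X Y : C} (f : X ⟶ Y), f ≫ η Y = η X ≫ T.map f) {A Y : C} (hA : η A = 0)
    (ρ : T.obj Y ⟶ Y) (hρ : η Y ≫ ρ = 𝟙 Y) (n : ℕ) : Subsingleton (Ext A Y n) := by
  refine subsingleton_of_forall_eq 0 fun e => ?_
  rw [← comp_mk₀_id e, ← hρ, ← mk₀_comp_mk₀, ← comp_assoc_of_second_deg_zero,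
    comp_mk₀_app_eq_zero T hT η hη hA, zero_comp]

end CategoryTheory.Abelian.Ext

end Effaceable

namespace QuantumFunctor

/-! ### Relations between the Hecke operators and the place permutations. -/

section HeckeRelations

variable {K : Type u} [Field K]

theorem swapWord_left {n d : ℕ} (i : ℕ) (hi : i + 1 < d) (w : Fin d → Fin n) :
    swapWord i hi w ⟨i, Nat.lt_of_succ_lt hi⟩ = w ⟨i + 1, hi⟩ := by
  simp [swapWord]

theorem swapWord_right {n d : ℕ} (i : ℕ) (hi : i + 1 < d) (w : Fin d → Fin n) :
    swapWord i hi w ⟨i + 1, hi⟩ = w ⟨i, Nat.lt_of_succ_lt hi⟩ := by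
  simp [swapWord]

theorem swapWord_of_ne {n d : ℕ} (i : ℕ) (hi : i + 1 < d) (w : Fin d → Fin n) (t : Fin d)
    (h₁ : (t : ℕ) ≠ i) (h₂ : (t : ℕ) ≠ i + 1) : swapWord i hi w t = w t := by
  unfold swapWord
  rw [Function.comp_apply, Equiv.swap_apply_of_ne_of_ne] <;> simpa [Fin.ext_iff]

theorem swapWord_swapWord {n d : ℕ} (i : ℕ) (hi : i + 1 < d) (w : Fin d → Fin n) :
    swapWord i hi (swapWord i hi w) = w := by
  funext t
  simp [swapWord]

theorem swapWord_eq_self {n d : ℕ} (i : ℕ) (hi : i + 1 < d) (w : Fin d → Fin n)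
    (h : w ⟨i, Nat.lt_of_succ_lt hi⟩ = w ⟨i + 1, hi⟩) : swapWord i hi w = w := by
  funext t
  by_cases h₁ : t = ⟨i, Nat.lt_of_succ_lt hi⟩
  · rw [h₁, swapWord_left, h]
  by_cases h₂ : t = ⟨i + 1, hi⟩
  · rw [h₂, swapWord_right, h]
  exact swapWord_of_ne i hi w t (by simpa [Fin.ext_iff] using h₁) (by simpa [Fin.ext_iff] using h₂)

theorem swapWord_comm {n d : ℕ} (i j : ℕ) (hi : i + 1 < d) (hj : j + 1 < d) (hij : i + 1 < j)
    (w : Fin d → Fin n) :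
    swapWord i hi (swapWord j hj w) = swapWord j hj (swapWord i hi w) := by
  have h := (Equiv.Perm.disjoint_swap_swap (x := (⟨i, by omega⟩ : Fin d)) (y := ⟨i + 1, hi⟩)
    (z := ⟨j, by omega⟩) (t := ⟨j + 1, hj⟩) (by simp; omega)).commute
  funext t
  exact congrArg w (DFunLike.congr_fun h.eq.symm t)

/-- The operator exchanging the tensor factors in positions `i` and `i + 1`. -/
def swapT (K : Type u) [Field K] (n d : ℕ) (i : ℕ) (hi : i + 1 < d) :
    TensorSpace K n d →ₗ[K] TensorSpace K n d :=
  (wordBasis K n d).constr K fun w => wordBasis K n d (swapWord i hi w)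

theorem swapT_wordBasis {n d : ℕ} (i : ℕ) (hi : i + 1 < d) (w : Fin d → Fin n) :
    swapT K n d i hi (wordBasis K n d w) = wordBasis K n d (swapWord i hi w) :=
  Module.Basis.constr_basis ..

theorem heckeT_wordBasis (q : K) {n d : ℕ} (i : ℕ) (hi : i + 1 < d) (w : Fin d → Fin n) :
    heckeT q n d i hi (wordBasis K n d w) =
      if w ⟨i, Nat.lt_of_succ_lt hi⟩ < w ⟨i + 1, hi⟩ then
        wordBasis K n d (swapWord i hi w)
      else if w ⟨i, Nat.lt_of_succ_lt hi⟩ = w ⟨i + 1, hi⟩ then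
        q • wordBasis K n d (swapWord i hi w)
      else
        (q - q⁻¹) • wordBasis K n d w + wordBasis K n d (swapWord i hi w) :=
  Module.Basis.constr_basis ..

theorem swapT_swapT {n d : ℕ} (i : ℕ) (hi : i + 1 < d) (x : TensorSpace K n d) :
    swapT K n d i hi (swapT K n d i hi x) = x := by
  refine LinearMap.congr_fun (f := swapT K n d i hi ∘ₗ swapT K n d i hi) (g := LinearMap.id)
    ((wordBasis K n d).ext fun w => ?_) x
  simp [swapT_wordBasis, swapWord_swapWord]

/-- Quadratic relation (T - q)(T + q⁻¹) = 0. The case of equal letters needs q q⁻¹ = 1. -/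
theorem heckeT_heckeT {q : K} (hq : q ≠ 0) {n d : ℕ} (i : ℕ) (hi : i + 1 < d)
    (x : TensorSpace K n d) :
    heckeT q n d i hi (heckeT q n d i hi x) = (q - q⁻¹) • heckeT q n d i hi x + x := by
  refine LinearMap.congr_fun (f := heckeT q n d i hi ∘ₗ heckeT q n d i hi)
    (g := (q - q⁻¹) • heckeT q n d i hi + LinearMap.id) ((wordBasis K n d).ext fun w => ?_) x
  rcases lt_trichotomy (w ⟨i, Nat.lt_of_succ_lt hi⟩) (w ⟨i + 1, hi⟩) with h | h | h
  · simp [heckeT_wordBasis, swapWord_left, swapWord_right, swapWord_swapWord, h, h.not_gt, h.ne']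
  · simp only [LinearMap.comp_apply, heckeT_wordBasis, swapWord_eq_self i hi w h, h, lt_irrefl,
      if_true, if_false, map_smul, LinearMap.add_apply, LinearMap.smul_apply, LinearMap.id_apply]
    match_scalars
    field_simp
    ring
  · simp [heckeT_wordBasis, swapWord_left, swapWord_right, swapWord_swapWord, h, h.not_gt, h.ne']

theorem swapT_comm {n d : ℕ} (i j : ℕ) (hi : i + 1 < d) (hj : j + 1 < d) (hij : i + 1 < j)
    (x : TensorSpace K n d) :
    swapT K n d i hi (swapT K n d j hj x) = swapT K n d j hj (swapT K n d i hi x) := by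
  refine LinearMap.congr_fun (f := swapT K n d i hi ∘ₗ swapT K n d j hj)
    (g := swapT K n d j hj ∘ₗ swapT K n d i hi) ((wordBasis K n d).ext fun w => ?_) x
  simp [swapT_wordBasis, swapWord_comm i j hi hj hij]

theorem heckeT_swapT_comm (q : K) {n d : ℕ} (i j : ℕ) (hi : i + 1 < d) (hj : j + 1 < d)
    (hij : i + 1 < j ∨ j + 1 < i) (x : TensorSpace K n d) :
    heckeT q n d i hi (swapT K n d j hj x) = swapT K n d j hj (heckeT q n d i hi x) := by
  refine LinearMap.congr_fun (f := heckeT q n d i hi ∘ₗ swapT K n d j hj)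
    (g := swapT K n d j hj ∘ₗ heckeT q n d i hi) ((wordBasis K n d).ext fun w => ?_) x
  have hc : swapWord i hi (swapWord j hj w) = swapWord j hj (swapWord i hi w) := by
    rcases hij with h | h
    · exact swapWord_comm i j hi hj h w
    · exact (swapWord_comm j i hj hi h w).symm
  have h₁ : swapWord j hj w ⟨i, Nat.lt_of_succ_lt hi⟩ = w ⟨i, Nat.lt_of_succ_lt hi⟩ :=
    swapWord_of_ne _ _ _ _ (by simp; omega) (by simp; omega)
  have h₂ : swapWord j hj w ⟨i + 1, hi⟩ = w ⟨i + 1, hi⟩ :=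
    swapWord_of_ne _ _ _ _ (by simp; omega) (by simp; omega)
  simp only [LinearMap.comp_apply, swapT_wordBasis, heckeT_wordBasis, h₁, h₂, hc]
  split_ifs <;> simp [swapT_wordBasis]

theorem heckeT_comm (q : K) {n d : ℕ} (i j : ℕ) (hi : i + 1 < d) (hj : j + 1 < d)
    (hij : i + 1 < j) (x : TensorSpace K n d) :
    heckeT q n d i hi (heckeT q n d j hj x) = heckeT q n d j hj (heckeT q n d i hi x) := by
  refine LinearMap.congr_fun (f := heckeT q n d i hi ∘ₗ heckeT q n d j hj)
    (g := heckeT q n d j hj ∘ₗ heckeT q n d i hi) ((wordBasis K n d).ext fun w => ?_) x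
  have hc := swapWord_comm i j hi hj hij w
  have h₁ : swapWord j hj w ⟨i, Nat.lt_of_succ_lt hi⟩ = w ⟨i, Nat.lt_of_succ_lt hi⟩ :=
    swapWord_of_ne _ _ _ _ (by simp; omega) (by simp; omega)
  have h₂ : swapWord j hj w ⟨i + 1, hi⟩ = w ⟨i + 1, hi⟩ :=
    swapWord_of_ne _ _ _ _ (by simp; omega) (by simp; omega)
  have h₃ : swapWord i hi w ⟨j, Nat.lt_of_succ_lt hj⟩ = w ⟨j, Nat.lt_of_succ_lt hj⟩ :=
    swapWord_of_ne _ _ _ _ (by simp; omega) (by simp; omega)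
  have h₄ : swapWord i hi w ⟨j + 1, hj⟩ = w ⟨j + 1, hj⟩ :=
    swapWord_of_ne _ _ _ _ (by simp; omega) (by simp; omega)
  simp only [LinearMap.comp_apply, heckeT_wordBasis q i hi w, heckeT_wordBasis q j hj w]
  by_cases a : w ⟨i, Nat.lt_of_succ_lt hi⟩ < w ⟨i + 1, hi⟩ <;>
    by_cases b : w ⟨i, Nat.lt_of_succ_lt hi⟩ = w ⟨i + 1, hi⟩ <;>
    by_cases c : w ⟨j, Nat.lt_of_succ_lt hj⟩ < w ⟨j + 1, hj⟩ <;>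
    by_cases e : w ⟨j, Nat.lt_of_succ_lt hj⟩ = w ⟨j + 1, hj⟩ <;>
    simp only [map_add, map_smul, heckeT_wordBasis, h₁, h₂, h₃, h₄, hc, if_true, if_false, a, b, c,
      e, lt_irrefl] <;> module

/-- The word `w` with the letters in positions `i`, `i + 1`, `i + 2` replaced by `x`, `y`, `z`. -/
def replaceThree {n d : ℕ} (i : ℕ) (w : Fin d → Fin n) (x y z : Fin n) : Fin d → Fin n := fun t =>
  if (t : ℕ) = i then x else if (t : ℕ) = i + 1 then y else if (t : ℕ) = i + 2 then z else w t

theorem replaceThree_self {n d : ℕ} (i : ℕ) (hi : i + 2 < d) (w : Fin d → Fin n) :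
    replaceThree i w (w ⟨i, by omega⟩) (w ⟨i + 1, by omega⟩) (w ⟨i + 2, hi⟩) = w := by
  funext t
  unfold replaceThree
  split_ifs with h₁ h₂ h₃ <;> first | rfl | exact congrArg w (Fin.ext (by simp only [*]))

theorem swapWord_replaceThree_left {n d : ℕ} (i : ℕ) (hi : i + 2 < d) (w : Fin d → Fin n)
    (x y z : Fin n) :
    swapWord i (by omega) (replaceThree i w x y z) = replaceThree i w y x z := by
  funext t
  simp only [swapWord, replaceThree, Function.comp_apply, Equiv.swap_apply_def, Fin.ext_iff]
  split_ifs <;> simp_all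

theorem swapWord_replaceThree_right {n d : ℕ} (i : ℕ) (hi : i + 2 < d) (w : Fin d → Fin n)
    (x y z : Fin n) :
    swapWord (i + 1) hi (replaceThree i w x y z) = replaceThree i w x z y := by
  funext t
  simp only [swapWord, replaceThree, Function.comp_apply, Equiv.swap_apply_def, Fin.ext_iff]
  split_ifs <;> grind

theorem heckeT_replaceThree_left (q : K) {n d : ℕ} (i : ℕ) (hi : i + 2 < d) (w : Fin d → Fin n)
    (x y z : Fin n) :
    heckeT q n d i (by omega) (wordBasis K n d (replaceThree i w x y z)) =
      if x < y then wordBasis K n d (replaceThree i w y x z)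
      else if x = y then q • wordBasis K n d (replaceThree i w y x z)
      else (q - q⁻¹) • wordBasis K n d (replaceThree i w x y z) +
        wordBasis K n d (replaceThree i w y x z) := by
  rw [heckeT_wordBasis, swapWord_replaceThree_left i hi]
  simp [replaceThree]

theorem heckeT_replaceThree_right (q : K) {n d : ℕ} (i : ℕ) (hi : i + 2 < d) (w : Fin d → Fin n)
    (x y z : Fin n) :
    heckeT q n d (i + 1) hi (wordBasis K n d (replaceThree i w x y z)) =
      if y < z then wordBasis K n d (replaceThree i w x z y)
      else if y = z then q • wordBasis K n d (replaceThree i w x z y)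
      else (q - q⁻¹) • wordBasis K n d (replaceThree i w x y z) +
        wordBasis K n d (replaceThree i w x z y) := by
  rw [heckeT_wordBasis, swapWord_replaceThree_right i hi]
  simp [replaceThree, show i + 1 + 1 ≠ i by omega]

theorem eq_of_replaceThree {n d : ℕ} {V : Type*} [AddCommGroup V] [Module K V] (i : ℕ)
    (hi : i + 2 < d) (f g : TensorSpace K n d →ₗ[K] V)
    (h : ∀ (w : Fin d → Fin n) (x y z : Fin n),
      f (wordBasis K n d (replaceThree i w x y z)) = g (wordBasis K n d (replaceThree i w x y z))) :
    f = g := by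
  refine (wordBasis K n d).ext fun w => ?_
  rw [← replaceThree_self i hi w]
  exact h _ _ _ _

theorem swapWord_braid {n d : ℕ} (i : ℕ) (hi : i + 2 < d) (w : Fin d → Fin n) :
    swapWord i (by omega) (swapWord (i + 1) hi (swapWord i (by omega) w)) =
      swapWord (i + 1) hi (swapWord i (by omega) (swapWord (i + 1) hi w)) := by
  rw [← replaceThree_self i hi w]
  simp only [swapWord_replaceThree_left i hi, swapWord_replaceThree_right i hi]

theorem swapT_braid {n d : ℕ} (i : ℕ) (hi : i + 2 < d) (x : TensorSpace K n d) :
    swapT K n d i (by omega) (swapT K n d (i + 1) hi (swapT K n d i (by omega) x)) =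
      swapT K n d (i + 1) hi (swapT K n d i (by omega) (swapT K n d (i + 1) hi x)) := by
  have key : (swapT K n d i (by omega) ∘ₗ swapT K n d (i + 1) hi ∘ₗ swapT K n d i (by omega)) =
      (swapT K n d (i + 1) hi ∘ₗ swapT K n d i (by omega) ∘ₗ swapT K n d (i + 1) hi) := by
    refine (wordBasis K n d).ext fun w => ?_
    simp [swapT_wordBasis, swapWord_braid]
  simpa only [LinearMap.comp_apply] using LinearMap.congr_fun key x

/-- The two exchanges carry the factors in positions i + 1, i + 2, in this order, to positions i, i
+ 1, so they carry an operator on the one pair to the same operator on the other. This mixed braid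
relation moves T past the sorting of a word in `liftComp_heckeT_of_eq`. -/
theorem heckeT_swapT_swapT (q : K) {n d : ℕ} (i : ℕ) (hi : i + 2 < d) (x : TensorSpace K n d) :
    heckeT q n d i (by omega) (swapT K n d (i + 1) hi (swapT K n d i (by omega) x)) =
      swapT K n d (i + 1) hi (swapT K n d i (by omega) (heckeT q n d (i + 1) hi x)) := by
  have key : (heckeT q n d i (by omega) ∘ₗ swapT K n d (i + 1) hi ∘ₗ swapT K n d i (by omega)) =
      (swapT K n d (i + 1) hi ∘ₗ swapT K n d i (by omega) ∘ₗ heckeT q n d (i + 1) hi) := by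
    refine eq_of_replaceThree i hi _ _ fun w a b c => ?_
    simp only [LinearMap.comp_apply, swapT_wordBasis, heckeT_replaceThree_left q i hi,
      heckeT_replaceThree_right q i hi, swapWord_replaceThree_left i hi,
      swapWord_replaceThree_right i hi]
    split_ifs <;> simp [swapT_wordBasis, swapWord_replaceThree_left i hi,
      swapWord_replaceThree_right i hi]
  simpa only [LinearMap.comp_apply] using LinearMap.congr_fun key x

theorem heckeT_swapT_swapT' (q : K) {n d : ℕ} (i : ℕ) (hi : i + 2 < d) (x : TensorSpace K n d) :
    heckeT q n d (i + 1) hi (swapT K n d i (by omega) (swapT K n d (i + 1) hi x)) =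
      swapT K n d i (by omega) (swapT K n d (i + 1) hi (heckeT q n d i (by omega) x)) := by
  have key : (heckeT q n d (i + 1) hi ∘ₗ swapT K n d i (by omega) ∘ₗ swapT K n d (i + 1) hi) =
      (swapT K n d i (by omega) ∘ₗ swapT K n d (i + 1) hi ∘ₗ heckeT q n d i (by omega)) := by
    refine eq_of_replaceThree i hi _ _ fun w a b c => ?_
    simp only [LinearMap.comp_apply, swapT_wordBasis, heckeT_replaceThree_left q i hi,
      heckeT_replaceThree_right q i hi, swapWord_replaceThree_left i hi,
      swapWord_replaceThree_right i hi]
    split_ifs <;> simp [swapT_wordBasis, swapWord_replaceThree_left i hi,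
      swapWord_replaceThree_right i hi]
  simpa only [LinearMap.comp_apply] using LinearMap.congr_fun key x

theorem heckeT_braid {q : K} (hq : q ≠ 0) {n d : ℕ} (i : ℕ) (hi : i + 2 < d)
    (x : TensorSpace K n d) :
    heckeT q n d i (by omega) (heckeT q n d (i + 1) hi (heckeT q n d i (by omega) x)) =
      heckeT q n d (i + 1) hi (heckeT q n d i (by omega) (heckeT q n d (i + 1) hi x)) := by
  have key : (heckeT q n d i (by omega) ∘ₗ heckeT q n d (i + 1) hi ∘ₗ heckeT q n d i (by omega)) =
      (heckeT q n d (i + 1) hi ∘ₗ heckeT q n d i (by omega) ∘ₗ heckeT q n d (i + 1) hi) := by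
    refine eq_of_replaceThree i hi _ _ fun w a b c => ?_
    simp only [LinearMap.comp_apply]
    -- Of the 27 outcomes of the three comparisons, 13 are consistent; each of these is an identity
    -- of coefficients in q.
    rcases lt_trichotomy a b with h | h | h <;> rcases lt_trichotomy b c with h' | h' | h' <;>
      rcases lt_trichotomy a c with h'' | h'' | h'' <;>
      first
      | exact absurd h'' (by omega)
      | (subst_vars
         simp only [heckeT_replaceThree_left q i hi, heckeT_replaceThree_right q i hi, map_add,
           map_smul, lt_irrefl, *, if_true, if_false, lt_asymm, ne_of_gt]
         first
         | done
         | (match_scalars <;> field_simp <;> ring))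
  simpa only [LinearMap.comp_apply] using LinearMap.congr_fun key x

end HeckeRelations

/-! ### Decomposition of V_{bn}^{⊗d} by words of blocks. -/

section Blocks

variable {K : Type u} [Field K]

/-! ### Letters made of a block and a value -/

/-- The word of blocks of a word in the letters `(block, value)`. -/
def blockWord {b n d : ℕ} (w : Fin d → Fin (b * n)) : Fin d → Fin b :=
  fun t => (finProdFinEquiv.symm (w t)).1

/-- The word of values of a word in the letters `(block, value)`. -/
def valueWord {b n d : ℕ} (w : Fin d → Fin (b * n)) : Fin d → Fin n :=
  fun t => (finProdFinEquiv.symm (w t)).2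

/-- The word with given blocks and values. -/
def joinWord {b n d : ℕ} (β : Fin d → Fin b) (v : Fin d → Fin n) : Fin d → Fin (b * n) :=
  fun t => finProdFinEquiv (β t, v t)

@[simp]
theorem blockWord_joinWord {b n d : ℕ} (β : Fin d → Fin b) (v : Fin d → Fin n) :
    blockWord (joinWord β v) = β := by
  funext t
  simp only [blockWord, joinWord, Equiv.symm_apply_apply]

@[simp]
theorem valueWord_joinWord {b n d : ℕ} (β : Fin d → Fin b) (v : Fin d → Fin n) :
    valueWord (joinWord β v) = v := by
  funext t
  simp only [valueWord, joinWord, Equiv.symm_apply_apply]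

@[simp]
theorem joinWord_blockWord {b n d : ℕ} (w : Fin d → Fin (b * n)) :
    joinWord (blockWord w) (valueWord w) = w := by
  funext t
  simp only [blockWord, valueWord, joinWord, Prod.mk.eta, Equiv.apply_symm_apply]

theorem swapWord_joinWord {b n d : ℕ} (i : ℕ) (hi : i + 1 < d) (β : Fin d → Fin b)
    (v : Fin d → Fin n) :
    swapWord i hi (joinWord β v) = joinWord (swapWord i hi β) (swapWord i hi v) := rfl

/-- The pair (block, value) is encoded as value + n · block, so the block is the leading digit. This
order makes the Hecke operators see blocks before values. -/
theorem finProdFinEquiv_lt {b n : ℕ} (x y : Fin b × Fin n) :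
    finProdFinEquiv x < finProdFinEquiv y ↔ x.1 < y.1 ∨ x.1 = y.1 ∧ x.2 < y.2 := by
  obtain ⟨a, u⟩ := x
  obtain ⟨c, v⟩ := y
  simp only [Fin.lt_def, finProdFinEquiv_apply_val, Fin.ext_iff]
  rcases lt_trichotomy (a : ℕ) c with h | h | h
  · have := Nat.mul_le_mul_left n (Nat.succ_le_of_lt h)
    have hu := u.2
    simp only [h, true_or, iff_true]
    rw [Nat.succ_eq_add_one, mul_add] at this
    omega
  · simp [h]
  · have := Nat.mul_le_mul_left n (Nat.succ_le_of_lt h)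
    have hv := v.2
    rw [Nat.succ_eq_add_one, mul_add] at this
    constructor <;> intro <;> omega

theorem finProdFinEquiv_eq {b n : ℕ} (x y : Fin b × Fin n) :
    finProdFinEquiv x = finProdFinEquiv y ↔ x.1 = y.1 ∧ x.2 = y.2 := by
  rw [finProdFinEquiv.injective.eq_iff, Prod.ext_iff]

/-- The projection onto the span of the words with a given word of blocks, followed by the map
that keeps the word of values. -/
def valT (K : Type u) [Field K] {b d : ℕ} (n : ℕ) (β : Fin d → Fin b) :
    TensorSpace K (b * n) d →ₗ[K] TensorSpace K n d :=
  (wordBasis K (b * n) d).constr K fun w =>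
    if blockWord w = β then wordBasis K n d (valueWord w) else 0

theorem valT_wordBasis {b n d : ℕ} (β : Fin d → Fin b) (w : Fin d → Fin (b * n)) :
    valT K n β (wordBasis K (b * n) d w) =
      if blockWord w = β then wordBasis K n d (valueWord w) else 0 :=
  Module.Basis.constr_basis ..

/-- The map that adds a given word of blocks to a word of values. -/
def labT (K : Type u) [Field K] {b d : ℕ} (n : ℕ) (β : Fin d → Fin b) :
    TensorSpace K n d →ₗ[K] TensorSpace K (b * n) d :=
  (wordBasis K n d).constr K fun v => wordBasis K (b * n) d (joinWord β v)

theorem labT_wordBasis {b n d : ℕ} (β : Fin d → Fin b) (v : Fin d → Fin n) :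
    labT K n β (wordBasis K n d v) = wordBasis K (b * n) d (joinWord β v) :=
  Module.Basis.constr_basis ..

theorem valT_labT {b n d : ℕ} (β γ : Fin d → Fin b) (x : TensorSpace K n d) :
    valT K n β (labT K n γ x) = if γ = β then x else 0 := by
  have key : valT K n β ∘ₗ labT K n γ = if γ = β then LinearMap.id else 0 := by
    refine (wordBasis K n d).ext fun w => ?_
    rw [LinearMap.comp_apply, labT_wordBasis, valT_wordBasis]
    split_ifs <;> simp_all
  have := LinearMap.congr_fun key x
  split_ifs at this ⊢ <;> exact this

/-- Together with `valT_labT`, this makes V_{bn}^{⊗d} a direct sum of copies of V_n^{⊗d} indexed by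
the words of blocks. -/
theorem sum_labT_valT {b n d : ℕ} (x : TensorSpace K (b * n) d) :
    ∑ β : Fin d → Fin b, labT K n β (valT K n β x) = x := by
  have key : ∑ β : Fin d → Fin b, labT K n β ∘ₗ valT K n β = LinearMap.id := by
    refine (wordBasis K (b * n) d).ext fun w => ?_
    simp only [LinearMap.sum_apply, LinearMap.comp_apply, valT_wordBasis, apply_ite, map_zero,
      labT_wordBasis]
    simp
  simpa using LinearMap.congr_fun key x

theorem valT_ext {b n d : ℕ} {x y : TensorSpace K (b * n) d}
    (h : ∀ β : Fin d → Fin b, valT K n β x = valT K n β y) : x = y := by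
  rw [← sum_labT_valT x, ← sum_labT_valT y]
  exact Finset.sum_congr rfl fun β _ => by rw [h β]

theorem eq_of_joinWord {b n d : ℕ} {V : Type*} [AddCommGroup V] [Module K V]
    (f g : TensorSpace K (b * n) d →ₗ[K] V)
    (h : ∀ (γ : Fin d → Fin b) (v : Fin d → Fin n),
      f (wordBasis K (b * n) d (joinWord γ v)) = g (wordBasis K (b * n) d (joinWord γ v))) :
    f = g := by
  refine (wordBasis K (b * n) d).ext fun w => ?_
  rw [← joinWord_blockWord w]
  exact h _ _

/-- Distinct blocks settle the comparison by themselves, and the values are merely exchanged; with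
equal blocks only the values matter. -/
theorem heckeT_joinWord (q : K) {b n d : ℕ} (i : ℕ) (hi : i + 1 < d) (γ : Fin d → Fin b)
    (v : Fin d → Fin n) :
    heckeT q (b * n) d i hi (wordBasis K (b * n) d (joinWord γ v)) =
      if γ ⟨i, Nat.lt_of_succ_lt hi⟩ < γ ⟨i + 1, hi⟩ then
        wordBasis K (b * n) d (joinWord (swapWord i hi γ) (swapWord i hi v))
      else if γ ⟨i, Nat.lt_of_succ_lt hi⟩ = γ ⟨i + 1, hi⟩ then
        labT K n γ (heckeT q n d i hi (wordBasis K n d v))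
      else (q - q⁻¹) • wordBasis K (b * n) d (joinWord γ v) +
        wordBasis K (b * n) d (joinWord (swapWord i hi γ) (swapWord i hi v)) := by
  rw [heckeT_wordBasis, heckeT_wordBasis, swapWord_joinWord]
  simp only [joinWord, finProdFinEquiv_lt, finProdFinEquiv_eq]
  rcases lt_trichotomy (γ ⟨i, Nat.lt_of_succ_lt hi⟩) (γ ⟨i + 1, hi⟩) with h | h | h
  · simp [h]
  · simp only [h, lt_irrefl, true_and, false_or, if_true, if_false, apply_ite (labT K n γ), map_add,
      map_smul, labT_wordBasis, swapWord_eq_self i hi γ h]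
  · simp [h.not_gt, h.ne']

theorem swapWord_eq_iff {n d : ℕ} (i : ℕ) (hi : i + 1 < d) (v w : Fin d → Fin n) :
    swapWord i hi v = w ↔ v = swapWord i hi w := by
  constructor <;> rintro rfl <;> rw [swapWord_swapWord]

theorem valT_heckeT_of_eq (q : K) {b n d : ℕ} (i : ℕ) (hi : i + 1 < d) (β : Fin d → Fin b)
    (h : β ⟨i, Nat.lt_of_succ_lt hi⟩ = β ⟨i + 1, hi⟩) (x : TensorSpace K (b * n) d) :
    valT K n β (heckeT q (b * n) d i hi x) = heckeT q n d i hi (valT K n β x) := by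
  have key : valT K n β ∘ₗ heckeT q (b * n) d i hi = heckeT q n d i hi ∘ₗ valT K n β := by
    refine eq_of_joinWord _ _ fun γ v => ?_
    have hs : swapWord i hi γ = β ↔ γ = β := by
      rw [swapWord_eq_iff, swapWord_eq_self i hi β h]
    rw [LinearMap.comp_apply, LinearMap.comp_apply, heckeT_joinWord]
    by_cases hγ : γ = β
    · subst hγ
      simp [h, valT_labT, valT_wordBasis]
    · split_ifs <;> simp [valT_labT, valT_wordBasis, hγ, hs]
  exact LinearMap.congr_fun key x

/-- At an ascent T_i has no diagonal term, so only words with blocks s_iβ contribute to the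
component at β. For a Hecke linear Φ and a word β with a descent at i, it follows that the component
of Φ(x) at β is the exchange of the component of Φ(T_i x) at s_iβ. The construction `liftComp` takes
this as its definition. -/
theorem valT_heckeT_of_lt (q : K) {b n d : ℕ} (i : ℕ) (hi : i + 1 < d) (β : Fin d → Fin b)
    (h : β ⟨i, Nat.lt_of_succ_lt hi⟩ < β ⟨i + 1, hi⟩) (x : TensorSpace K (b * n) d) :
    valT K n β (heckeT q (b * n) d i hi x) =
      swapT K n d i hi (valT K n (swapWord i hi β) x) := by
  have key : valT K n β ∘ₗ heckeT q (b * n) d i hi =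
      swapT K n d i hi ∘ₗ valT K n (swapWord i hi β) := by
    refine eq_of_joinWord _ _ fun γ v => ?_
    rw [LinearMap.comp_apply, LinearMap.comp_apply, heckeT_joinWord]
    by_cases hγ : γ = swapWord i hi β
    · subst hγ
      have hne : swapWord i hi β ≠ β := fun h' => h.ne (by
        rw [← swapWord_left i hi β, h'])
      simp [swapWord_left, swapWord_right, h.not_gt, h.ne', valT_wordBasis, swapT_wordBasis,
        swapWord_swapWord, hne]
    · by_cases hγ' : γ = β
      · subst hγ'
        have hne : swapWord i hi γ ≠ γ := fun h' => h.ne (by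
          rw [← swapWord_left i hi γ, h'])
        simp [h, valT_wordBasis, hne, hne.symm]
      · split_ifs <;> simp [valT_labT, valT_wordBasis, hγ, hγ', swapWord_eq_iff]
  exact LinearMap.congr_fun key x

theorem valT_heckeT_of_gt (q : K) {b n d : ℕ} (i : ℕ) (hi : i + 1 < d) (β : Fin d → Fin b)
    (h : β ⟨i + 1, hi⟩ < β ⟨i, Nat.lt_of_succ_lt hi⟩) (x : TensorSpace K (b * n) d) :
    valT K n β (heckeT q (b * n) d i hi x) =
      (q - q⁻¹) • valT K n β x + swapT K n d i hi (valT K n (swapWord i hi β) x) := by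
  have key : valT K n β ∘ₗ heckeT q (b * n) d i hi =
      (q - q⁻¹) • valT K n β + swapT K n d i hi ∘ₗ valT K n (swapWord i hi β) := by
    refine eq_of_joinWord _ _ fun γ v => ?_
    rw [LinearMap.comp_apply, LinearMap.add_apply, LinearMap.smul_apply, LinearMap.comp_apply,
      heckeT_joinWord]
    by_cases hγ : γ = swapWord i hi β
    · subst hγ
      have hne : swapWord i hi β ≠ β := fun h' => h.ne' (by
        rw [← swapWord_left i hi β, h'])
      simp [swapWord_left, swapWord_right, h, valT_wordBasis, swapT_wordBasis,
        swapWord_swapWord, hne]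
    · by_cases hγ' : γ = β
      · subst hγ'
        have hne : swapWord i hi γ ≠ γ := fun h' => h.ne' (by
          rw [← swapWord_left i hi γ, h'])
        simp [h.not_gt, h.ne', valT_wordBasis, hne, hne.symm]
      · split_ifs <;> simp [valT_labT, valT_wordBasis, hγ, hγ', swapWord_eq_iff]
  exact LinearMap.congr_fun key x

/-! ### Hecke linear maps are determined by their components on sorted words of blocks -/

/-- The letters of the word increase weakly. -/
def NoDescent {b d : ℕ} (β : Fin d → Fin b) : Prop :=
  ∀ (i : ℕ) (hi : i + 1 < d), β ⟨i, Nat.lt_of_succ_lt hi⟩ ≤ β ⟨i + 1, hi⟩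

theorem toLex_swapWord_lt {b d : ℕ} (i : ℕ) (hi : i + 1 < d) (β : Fin d → Fin b)
    (h : β ⟨i + 1, hi⟩ < β ⟨i, Nat.lt_of_succ_lt hi⟩) :
    toLex (swapWord i hi β) < toLex β := by
  refine ⟨⟨i, Nat.lt_of_succ_lt hi⟩, fun t ht => ?_, ?_⟩
  · have ht' : (t : ℕ) < i := ht
    exact swapWord_of_ne i hi β t (by omega) (by omega)
  · change swapWord i hi β ⟨i, _⟩ < β ⟨i, _⟩
    rwa [swapWord_left]

theorem lex_induction {b d : ℕ} {P : (Fin d → Fin b) → Prop}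
    (h : ∀ β, (∀ γ, toLex γ < toLex β → P γ) → P β) (β : Fin d → Fin b) : P β :=
  (InvImage.wf (fun β : Fin d → Fin b => toLex β) wellFounded_lt).induction β h

/-- Uniqueness half of Frobenius reciprocity. Exchanging a descent lowers the word
lexicographically, and a component at a word with a descent is determined by the component at the
lower word. -/
theorem schur_ext_of_noDescent (q : K) {r b n d : ℕ} (Φ Ψ : schur q r (b * n) d)
    (h : ∀ β : Fin d → Fin b, NoDescent β → ∀ x, valT K n β (Φ.1 x) = valT K n β (Ψ.1 x)) :
    Φ = Ψ := by
  refine Subtype.ext (LinearMap.ext fun x => valT_ext fun β => ?_)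
  -- The vector must vary, because the recursion replaces x by T_i x.
  induction β using lex_induction generalizing x with
  | h β ih =>
    by_cases hβ : NoDescent β
    · exact h β hβ x
    simp only [NoDescent, not_forall, not_le] at hβ
    obtain ⟨i, hi, hlt⟩ := hβ
    have hs : swapWord i hi β ⟨i, Nat.lt_of_succ_lt hi⟩ < swapWord i hi β ⟨i + 1, hi⟩ := by
      rwa [swapWord_left, swapWord_right]
    have aux (Θ : schur q r (b * n) d) : swapT K n d i hi (valT K n β (Θ.1 x)) =
        valT K n (swapWord i hi β) (Θ.1 (heckeT q r d i hi x)) := by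
      rw [← LinearMap.comp_apply Θ.1, Θ.2 i hi, LinearMap.comp_apply, valT_heckeT_of_lt q i hi _ hs,
        swapWord_swapWord]
    rw [← swapT_swapT i hi (valT K n β (Φ.1 x)), ← swapT_swapT i hi (valT K n β (Ψ.1 x)), aux, aux,
      ih _ (toLex_swapWord_lt i hi β hlt)]

end Blocks

section Lift

variable {K : Type u} [Field K]

/-! ### Coinduction: Hecke linear maps with given components on sorted words of blocks -/

open Classical in
/-- The components of the Hecke linear map whose components on sorted words of blocks are given:
a word of blocks is sorted by exchanging the letters of a descent. -/
def liftComp (q : K) {r b n d : ℕ} (φ : (Fin d → Fin b) → TensorSpace K r d →ₗ[K] TensorSpace K n d) :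
    (Fin d → Fin b) → TensorSpace K r d →ₗ[K] TensorSpace K n d :=
  (InvImage.wf (fun β : Fin d → Fin b => toLex β) wellFounded_lt).fix fun β rec =>
    if h : ∃ (i : ℕ) (hi : i + 1 < d), β ⟨i + 1, hi⟩ < β ⟨i, Nat.lt_of_succ_lt hi⟩ then
      swapT K n d h.choose h.choose_spec.choose ∘ₗ
        rec (swapWord h.choose h.choose_spec.choose β)
          (toLex_swapWord_lt _ _ _ h.choose_spec.choose_spec) ∘ₗ
          heckeT q r d h.choose h.choose_spec.choose
    else φ β

variable {q : K} {r b n d : ℕ} {φ : (Fin d → Fin b) → TensorSpace K r d →ₗ[K] TensorSpace K n d}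

theorem liftComp_of_noDescent {β : Fin d → Fin b} (h : NoDescent β) : liftComp q φ β = φ β := by
  rw [liftComp, WellFounded.fix_eq, dif_neg]
  rintro ⟨i, hi, hlt⟩
  exact hlt.not_ge (h i hi)

theorem exists_liftComp_eq {β : Fin d → Fin b} (h : ¬ NoDescent β) :
    ∃ (i : ℕ) (hi : i + 1 < d), β ⟨i + 1, hi⟩ < β ⟨i, Nat.lt_of_succ_lt hi⟩ ∧
      ∀ x, liftComp q φ β x =
        swapT K n d i hi (liftComp q φ (swapWord i hi β) (heckeT q r d i hi x)) := by
  simp only [NoDescent, not_forall, not_le] at h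
  refine ⟨h.choose, h.choose_spec.choose, h.choose_spec.choose_spec, fun x => ?_⟩
  rw [liftComp, WellFounded.fix_eq, dif_pos h]
  rfl

/-- The definition picks an arbitrary descent; this is independence of the pick, by a diamond
argument along the lexicographic order. Two distant descents commute. Two adjacent ones meet by the
braid relations, which hold for the exchanges of values and for the Hecke operators on the source
alike. -/
theorem liftComp_of_gt (hq : q ≠ 0) (β : Fin d → Fin b) (i : ℕ) (hi : i + 1 < d)
    (h : β ⟨i + 1, hi⟩ < β ⟨i, Nat.lt_of_succ_lt hi⟩) (x : TensorSpace K r d) :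
    liftComp q φ β x =
      swapT K n d i hi (liftComp q φ (swapWord i hi β) (heckeT q r d i hi x)) := by
  induction β using lex_induction generalizing i x with
  | h β ih =>
    obtain ⟨j, hj, hlt, hβ⟩ := exists_liftComp_eq (φ := φ) (q := q) (β := β)
      fun h' => h.not_ge (h' i hi)
    have far (i j : ℕ) (hi : i + 1 < d) (hj : j + 1 < d) (hij : i + 1 < j)
        (h : β ⟨i + 1, hi⟩ < β ⟨i, Nat.lt_of_succ_lt hi⟩)
        (h' : β ⟨j + 1, hj⟩ < β ⟨j, Nat.lt_of_succ_lt hj⟩) :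
        swapT K n d i hi (liftComp q φ (swapWord i hi β) (heckeT q r d i hi x)) =
          swapT K n d j hj (liftComp q φ (swapWord j hj β) (heckeT q r d j hj x)) := by
      rw [ih _ (toLex_swapWord_lt i hi β h) j hj, ih _ (toLex_swapWord_lt j hj β h') i hi,
        swapT_comm i j hi hj hij, swapWord_comm i j hi hj hij, heckeT_comm q i j hi hj hij]
      · rwa [swapWord_of_ne j hj β _ (by simp; omega) (by simp; omega),
          swapWord_of_ne j hj β _ (by simp; omega) (by simp; omega)]
      · rwa [swapWord_of_ne i hi β _ (by simp; omega) (by simp; omega),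
          swapWord_of_ne i hi β _ (by simp; omega) (by simp; omega)]
    -- Three strictly decreasing letters: each path is continued to three exchanges, where both
    -- reach the reversed triple.
    have near (i : ℕ) (hi : i + 1 < d) (hi' : i + 1 + 1 < d)
        (h : β ⟨i + 1, hi⟩ < β ⟨i, Nat.lt_of_succ_lt hi⟩)
        (h' : β ⟨i + 1 + 1, hi'⟩ < β ⟨i + 1, hi⟩) :
        swapT K n d i hi (liftComp q φ (swapWord i hi β) (heckeT q r d i hi x)) =
          swapT K n d (i + 1) hi' (liftComp q φ (swapWord (i + 1) hi' β)
            (heckeT q r d (i + 1) hi' x)) := by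
      have a₁ := swapWord_left i hi β
      have a₂ := swapWord_right i hi β
      have a₃ := swapWord_of_ne i hi β ⟨i + 1 + 1, hi'⟩ (by dsimp only; omega) (by dsimp only; omega)
      have b₁ := swapWord_left (i + 1) hi' β
      have b₂ := swapWord_right (i + 1) hi' β
      have b₃ := swapWord_of_ne (i + 1) hi' β ⟨i, by omega⟩ (by dsimp only; omega) (by dsimp only; omega)
      have l₁ := toLex_swapWord_lt i hi β h
      have l₂ := toLex_swapWord_lt (i + 1) hi' β h'
      have c₁ : swapWord i hi β ⟨i + 1 + 1, hi'⟩ < swapWord i hi β ⟨i + 1, hi⟩ := by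
        rw [a₂, a₃]; exact h'.trans h
      have c₂ : swapWord (i + 1) hi' β ⟨i + 1, hi⟩ < swapWord (i + 1) hi' β ⟨i, by omega⟩ := by
        rw [b₁, b₃]; exact h'.trans h
      have m₁ := toLex_swapWord_lt (i + 1) hi' _ c₁
      have m₂ := toLex_swapWord_lt i hi _ c₂
      rw [ih _ l₁ (i + 1) hi' c₁, ih _ l₂ i hi c₂, ih _ (m₁.trans l₁) i hi,
        ih _ (m₂.trans l₂) (i + 1) hi', swapT_braid i hi', swapWord_braid i hi',
        heckeT_braid hq i hi']
      · rw [swapWord_right, swapWord_of_ne i hi _ ⟨i + 1 + 1, hi'⟩ (by dsimp only; omega) (by dsimp only; omega), b₂, b₃]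
        exact h
      · rw [swapWord_left, swapWord_of_ne (i + 1) hi' _ ⟨i, _⟩ (by dsimp only; omega) (by dsimp only; omega), a₁, a₃]
        exact h'
    rw [hβ]
    rcases lt_trichotomy i j with hij | rfl | hij
    · rcases Nat.lt_or_ge (i + 1) j with hij' | hij'
      · exact (far i j hi hj hij' h hlt).symm
      · obtain rfl : j = i + 1 := by omega
        exact (near i hi hj h hlt).symm
    · rfl
    · rcases Nat.lt_or_ge (j + 1) i with hij' | hij'
      · exact far j i hj hi hij' hlt h
      · obtain rfl : i = j + 1 := by omega
        exact near j hj hi hlt h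

/-- Parabolic linearity spreads from sorted words to all words. A descent away from the equal pair
commutes with it. When a descent shares a letter with the pair, two exchanges move the third letter
past the pair, shifting the pair by one place; the braid relation on the source and the mixed one on
the values then match. -/
theorem liftComp_heckeT_of_eq (hq : q ≠ 0)
    (hφ : ∀ β, NoDescent β → ∀ (i : ℕ) (hi : i + 1 < d),
      β ⟨i, Nat.lt_of_succ_lt hi⟩ = β ⟨i + 1, hi⟩ →
      ∀ x, φ β (heckeT q r d i hi x) = heckeT q n d i hi (φ β x))
    (β : Fin d → Fin b) (i : ℕ) (hi : i + 1 < d)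
    (h : β ⟨i, Nat.lt_of_succ_lt hi⟩ = β ⟨i + 1, hi⟩) (x : TensorSpace K r d) :
    liftComp q φ β (heckeT q r d i hi x) = heckeT q n d i hi (liftComp q φ β x) := by
  induction β using lex_induction generalizing i x with
  | h β ih =>
    by_cases hβ : NoDescent β
    · rw [liftComp_of_noDescent hβ, hφ β hβ i hi h]
    obtain ⟨j, hj, hlt, hβ⟩ := exists_liftComp_eq (φ := φ) (q := q) hβ
    have hlj := toLex_swapWord_lt j hj β hlt
    have far (hij : i + 1 < j ∨ j + 1 < i) :
        liftComp q φ β (heckeT q r d i hi x) = heckeT q n d i hi (liftComp q φ β x) := by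
      have hc : heckeT q r d j hj (heckeT q r d i hi x) =
          heckeT q r d i hi (heckeT q r d j hj x) := by
        rcases hij with hij | hij
        · exact (heckeT_comm q i j hi hj hij x).symm
        · exact heckeT_comm q j i hj hi hij x
      rw [hβ, hβ, hc, ih _ hlj i hi, heckeT_swapT_comm q i j hi hj hij]
      rwa [swapWord_of_ne j hj β _ (by simp; omega) (by simp; omega),
        swapWord_of_ne j hj β _ (by simp; omega) (by simp; omega)]
    rcases lt_trichotomy i j with hij | rfl | hij
    · rcases Nat.lt_or_ge (i + 1) j with hij' | hij'
      · exact far (.inl hij')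
      · obtain rfl : j = i + 1 := by omega
        have a₁ := swapWord_left (i + 1) hj β
        have a₂ := swapWord_right (i + 1) hj β
        have a₃ := swapWord_of_ne (i + 1) hj β ⟨i, by omega⟩ (by dsimp only; omega) (by dsimp only; omega)
        have c : swapWord (i + 1) hj β ⟨i + 1, hi⟩ < swapWord (i + 1) hj β ⟨i, by omega⟩ := by
          rw [a₁, a₃, h]; exact hlt
        have hl := toLex_swapWord_lt i hi _ c
        rw [hβ, hβ, liftComp_of_gt hq _ i hi c, liftComp_of_gt hq _ i hi c, heckeT_braid hq i hj,
          ih _ (hl.trans hlj) (i + 1) hj, ← heckeT_swapT_swapT q i hj]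
        rw [swapWord_right, swapWord_of_ne i hi _ ⟨i + 1 + 1, hj⟩ (by dsimp only; omega) (by dsimp only; omega), a₂, a₃, h]
    · exact absurd hlt (by rw [h]; exact lt_irrefl _)
    · rcases Nat.lt_or_ge (j + 1) i with hij' | hij'
      · exact far (.inr hij')
      · obtain rfl : i = j + 1 := by omega
        have a₁ := swapWord_left j hj β
        have a₂ := swapWord_right j hj β
        have a₃ := swapWord_of_ne j hj β ⟨j + 1 + 1, hi⟩ (by dsimp only; omega) (by dsimp only; omega)
        have c : swapWord j hj β ⟨j + 1 + 1, hi⟩ < swapWord j hj β ⟨j + 1, hj⟩ := by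
          rw [a₂, a₃, ← h]; exact hlt
        have hl := toLex_swapWord_lt (j + 1) hi _ c
        rw [hβ, hβ, liftComp_of_gt hq _ (j + 1) hi c, liftComp_of_gt hq _ (j + 1) hi c,
          ← heckeT_braid hq j hi, ih _ (hl.trans hlj) j hj, ← heckeT_swapT_swapT' q j hi]
        rw [swapWord_left, swapWord_of_ne (j + 1) hi _ ⟨j, _⟩ (by dsimp only; omega) (by dsimp only; omega), a₁, a₃, h]

/-- The component at β is built from the given one at a sorted rearrangement of β, so a condition
stable under exchanges bounds the support. It is applied to the condition that every block occurs.
-/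
theorem liftComp_eq_zero (P : (Fin d → Fin b) → Prop)
    (hP : ∀ (i : ℕ) (hi : i + 1 < d) (β : Fin d → Fin b), P (swapWord i hi β) → P β)
    (hφ : ∀ β, NoDescent β → ¬ P β → φ β = 0) (β : Fin d → Fin b) (h : ¬ P β) :
    liftComp q φ β = 0 := by
  induction β using lex_induction with
  | h β ih =>
    by_cases hβ : NoDescent β
    · rw [liftComp_of_noDescent hβ, hφ β hβ h]
    obtain ⟨j, hj, hlt, hβ⟩ := exists_liftComp_eq (φ := φ) (q := q) hβ
    refine LinearMap.ext fun x => ?_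
    rw [hβ, ih _ (toLex_swapWord_lt j hj β hlt) fun h' => h (hP j hj β h')]
    simp

/-- The Hecke linear map whose components on sorted words of blocks are given. -/
def lift (hq : q ≠ 0) (φ : (Fin d → Fin b) → TensorSpace K r d →ₗ[K] TensorSpace K n d)
    (hφ : ∀ β, NoDescent β → ∀ (i : ℕ) (hi : i + 1 < d),
      β ⟨i, Nat.lt_of_succ_lt hi⟩ = β ⟨i + 1, hi⟩ →
      ∀ x, φ β (heckeT q r d i hi x) = heckeT q n d i hi (φ β x)) : schur q r (b * n) d :=
  ⟨∑ β : Fin d → Fin b, labT K n β ∘ₗ liftComp q φ β, by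
    have hval (β : Fin d → Fin b) (x) :
        valT K n β ((∑ β : Fin d → Fin b, labT K n β ∘ₗ liftComp q φ β) x) =
          liftComp q φ β x := by
      simp [LinearMap.sum_apply, valT_labT]
    intro i hi
    refine LinearMap.ext fun x => valT_ext fun β => ?_
    rw [LinearMap.comp_apply, LinearMap.comp_apply, hval]
    -- An ascent is the recursion read backwards, equality is parabolic linearity, and a descent is
    -- the recursion combined with the quadratic relation.
    rcases lt_trichotomy (β ⟨i, Nat.lt_of_succ_lt hi⟩) (β ⟨i + 1, hi⟩) with h | h | h
    · rw [valT_heckeT_of_lt q i hi β h, hval, liftComp_of_gt hq (swapWord i hi β) i hi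
        (by rwa [swapWord_left, swapWord_right]), swapT_swapT, swapWord_swapWord]
    · rw [valT_heckeT_of_eq q i hi β h, hval, liftComp_heckeT_of_eq hq hφ β i hi h]
    · rw [valT_heckeT_of_gt q i hi β h, hval, hval, liftComp_of_gt hq β i hi h,
        liftComp_of_gt hq β i hi h, heckeT_heckeT hq]
      simp only [map_add, map_smul]⟩

theorem valT_lift (hq : q ≠ 0) (hφ) (β : Fin d → Fin b) (x : TensorSpace K r d) :
    valT K n β ((lift hq φ hφ).1 x) = liftComp q φ β x := by
  simp [lift, LinearMap.sum_apply, valT_labT]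

theorem valT_lift_of_noDescent (hq : q ≠ 0) (hφ) {β : Fin d → Fin b} (h : NoDescent β)
    (x : TensorSpace K r d) : valT K n β ((lift hq φ hφ).1 x) = φ β x := by
  rw [valT_lift, liftComp_of_noDescent h]

end Lift

/-! ### The exact endofunctor T and the transformation η. -/

section BlowUp

variable {K : Type u} [Field K] {q : K}

/-! ### Replacing `V_n` by the sum of `b` copies of `V_n` -/

/-- The Hecke linear map `V_{b n}^{⊗ d} → V_{b m}^{⊗ d}` that acts by `f` on the values of the
words with a given sorted word of blocks. -/
def blowUp (hq : q ≠ 0) (b : ℕ) {n m d : ℕ} (f : schur q n m d) : schur q (b * n) (b * m) d :=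
  lift hq (fun β => f.1 ∘ₗ valT K n β) fun β _ i hi h x => by
    rw [LinearMap.comp_apply, valT_heckeT_of_eq q i hi β h, ← LinearMap.comp_apply, f.2 i hi]
    rfl

theorem valT_blowUp (hq : q ≠ 0) {b n m d : ℕ} (f : schur q n m d) {β : Fin d → Fin b}
    (h : NoDescent β) (x : TensorSpace K (b * n) d) :
    valT K m β ((blowUp hq b f).1 x) = f.1 (valT K n β x) :=
  valT_lift_of_noDescent hq _ h x

theorem blowUp_id (hq : q ≠ 0) (b n d : ℕ) :
    blowUp hq b (schurId q n d) = schurId q (b * n) d :=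
  schur_ext_of_noDescent q _ _ fun _ hβ x => valT_blowUp hq _ hβ x

theorem blowUp_comp (hq : q ≠ 0) (b : ℕ) {n r m d : ℕ} (g : schur q r m d) (f : schur q n r d) :
    blowUp hq b (schurComp g f) = schurComp (blowUp hq b g) (blowUp hq b f) :=
  schur_ext_of_noDescent q _ _ fun _ hβ x => by
    rw [valT_blowUp hq _ hβ]
    exact ((valT_blowUp hq g hβ _).trans (congrArg g.1 (valT_blowUp hq f hβ x))).symm

theorem blowUp_add (hq : q ≠ 0) (b : ℕ) {n m d : ℕ} (f g : schur q n m d) :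
    blowUp hq b (f + g) = blowUp hq b f + blowUp hq b g :=
  schur_ext_of_noDescent q _ _ fun _ hβ x => by
    rw [valT_blowUp hq _ hβ, Submodule.coe_add, Submodule.coe_add, LinearMap.add_apply,
      LinearMap.add_apply, map_add, valT_blowUp hq _ hβ, valT_blowUp hq _ hβ]

theorem blowUp_smul (hq : q ≠ 0) (b : ℕ) {n m d : ℕ} (c : K) (f : schur q n m d) :
    blowUp hq b (c • f) = c • blowUp hq b f :=
  schur_ext_of_noDescent q _ _ fun _ hβ x => by
    rw [valT_blowUp hq _ hβ, Submodule.coe_smul, Submodule.coe_smul, LinearMap.smul_apply,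
      LinearMap.smul_apply, map_smul, valT_blowUp hq _ hβ]

open Classical in
/-- The Hecke linear map `V_n^{⊗ d} → V_{b n}^{⊗ d}` whose component on a given word of blocks is
the identity, and whose components on the other sorted words of blocks are zero. The map is zero
if the given word does not have length `d`. -/
def diag (hq : q ≠ 0) {b : ℕ} (σ : Σ D : ℕ, Fin D → Fin b) (n d : ℕ) : schur q n (b * n) d :=
  lift hq (fun β => if (⟨d, β⟩ : Σ D : ℕ, Fin D → Fin b) = σ then LinearMap.id else 0)
    fun β _ i hi h x => by
      split_ifs <;> simp

open Classical in
theorem valT_diag (hq : q ≠ 0) {b : ℕ} (σ : Σ D : ℕ, Fin D → Fin b) (n d : ℕ) {β : Fin d → Fin b}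
    (h : NoDescent β) (x : TensorSpace K n d) :
    valT K n β ((diag hq σ n d).1 x) =
      if (⟨d, β⟩ : Σ D : ℕ, Fin D → Fin b) = σ then x else 0 := by
  rw [diag, valT_lift_of_noDescent hq _ h]
  split_ifs <;> rfl

/-- Naturality of `diag` in n: at an increasing word of blocks both sides have component f or 0,
according to whether the word is σ. -/
theorem blowUp_diag (hq : q ≠ 0) {b : ℕ} (σ : Σ D : ℕ, Fin D → Fin b) {n m d : ℕ}
    (f : schur q n m d) :
    schurComp (blowUp hq b f) (diag hq σ n d) = schurComp (diag hq σ m d) f :=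
  schur_ext_of_noDescent q _ _ fun _ hβ x => by
    refine (valT_blowUp hq f hβ _).trans (Eq.trans ?_ (valT_diag hq σ m d hβ (f.1 x)).symm)
    rw [valT_diag hq σ n d hβ]
    split_ifs <;> simp

/-- Exchanges do not change the set of letters of a word, so rearrangements of σ still use every
block. -/
theorem valT_diag_eq_zero (hq : q ≠ 0) {b : ℕ} (σ : Σ D : ℕ, Fin D → Fin b)
    (hσ : Function.Surjective σ.2) (n d : ℕ) (β : Fin d → Fin b) (h : ¬ Function.Surjective β)
    (x : TensorSpace K n d) : valT K n β ((diag hq σ n d).1 x) = 0 := by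
  rw [diag, valT_lift, liftComp_eq_zero Function.Surjective ?_ ?_ β h, LinearMap.zero_apply]
  · intro i hi β hβ
    exact hβ.of_comp
  · intro β _ hβ
    rw [if_neg]
    rintro rfl
    exact hβ hσ

/-! ### Weights -/

theorem card_content_joinWord {b n d : ℕ} (β : Fin d → Fin b) (hβ : Function.Surjective β)
    (v : Fin d → Fin n) :
    b ≤ (Finset.univ.filter fun j => content (joinWord β v) j ≠ 0).card := by
  choose t ht using hβ
  have h := Finset.card_le_card_of_injOn (s := (Finset.univ : Finset (Fin b)))
    (t := Finset.univ.filter fun j => content (joinWord β v) j ≠ 0)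
    (fun c => joinWord β v (t c)) (fun c _ => ?_) (fun c _ c' _ h => ?_)
  · simpa using h
  · simp only [Finset.coe_filter, Finset.mem_univ, true_and, Set.mem_ofPred_eq, content, ne_eq,
      Finset.card_eq_zero]
    exact Finset.ne_empty_of_mem (a := t c) (by simp)
  · simp only [joinWord] at h
    have := ((finProdFinEquiv_eq _ _).1 h).1
    simpa [ht] using this

/-- Words in which all b blocks occur have at least b distinct letters, hence a content with at
least b non-zero parts. -/
theorem xi_diag_eq_zero (hq : q ≠ 0) {b : ℕ} (σ : Σ D : ℕ, Fin D → Fin b)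
    (hσ : Function.Surjective σ.2) (n d : ℕ) (α : Fin (b * n) → ℕ)
    (hα : (Finset.univ.filter fun j => α j ≠ 0).card < b) :
    schurComp (xi q (b * n) d α) (diag hq σ n d) = 0 := by
  refine Subtype.ext (LinearMap.ext fun x => ?_)
  change weightProj K (b * n) d α ((diag hq σ n d).1 x) = 0
  rw [← sum_labT_valT ((diag hq σ n d).1 x), map_sum]
  refine Finset.sum_eq_zero fun β _ => ?_
  by_cases hβ : Function.Surjective β
  · have key : weightProj K (b * n) d α ∘ₗ labT K n β = 0 := by
      refine (wordBasis K n d).ext fun v => ?_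
      rw [LinearMap.comp_apply, labT_wordBasis, weightProj, Module.Basis.constr_basis, if_neg]
      · rfl
      · rintro rfl
        exact hα.not_ge (card_content_joinWord β hβ v)
    exact LinearMap.congr_fun key _
  · rw [valT_diag_eq_zero hq σ hσ n d β hβ, map_zero, map_zero]

/-- Decomposition of 1 into weight idempotents; the index set is the finite set of contents that
occur. -/
theorem sum_xi (q : K) (n d : ℕ) :
    ∑ α ∈ Finset.univ.image (content (n := n) (d := d)), xi q n d α = schurId q n d := by
  refine Subtype.ext ((wordBasis K n d).ext fun w => ?_)
  rw [Submodule.coe_sum, LinearMap.sum_apply]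
  simp only [xi, weightProj, Module.Basis.constr_basis]
  rw [Finset.sum_ite_eq, if_pos (Finset.mem_image_of_mem _ (Finset.mem_univ w))]
  rfl

/-- The number `(k + 1) * n`. -/
def mulRank (k : ℕ) (n : ℕ+) : ℕ+ := ⟨(k + 1) * n, Nat.mul_pos k.succ_pos n.pos⟩

/-- Insert 1 = ∑ ξ_α after `diag`. If α is not a weight of F, then ξ_α acts as zero; if it is, then
α has at most k non-zero parts and ξ_α kills `diag` already in the source category. -/
theorem HomogFunctor.act_diag_eq_zero (hq : q ≠ 0) {k d : ℕ} (F : HomogFunctor q d)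
    (hF : ∀ (n : ℕ+) (α : Fin n → ℕ), F.IsWeight n α →
      (Finset.univ.filter fun j => α j ≠ 0).card ≤ k)
    (σ : Σ D : ℕ, Fin D → Fin (k + 1)) (hσ : Function.Surjective σ.2) (n : ℕ+) :
    F.act n (mulRank k n) (diag hq σ n d) = 0 := by
  have h : F.act n (mulRank k n) (diag hq σ n d) =
      F.act (mulRank k n) (mulRank k n) (schurId q (mulRank k n) d) ∘ₗ
        F.act n (mulRank k n) (diag hq σ n d) := by
    rw [F.act_id]
    rfl
  rw [h, ← sum_xi, map_sum]
  refine LinearMap.ext fun x => ?_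
  rw [LinearMap.comp_apply, LinearMap.sum_apply]
  refine Finset.sum_eq_zero fun α _ => ?_
  by_cases hα : F.IsWeight (mulRank k n) α
  · have hz : schurComp (xi q (mulRank k n) d α) (diag hq σ n d : schur q n (mulRank k n) d) = 0 :=
      xi_diag_eq_zero hq σ hσ n d α (Nat.lt_succ_of_le (hF _ α hα))
    have h' := F.act_comp n (mulRank k n) (mulRank k n) (xi q _ d α) (diag hq σ n d)
    rw [hz, map_zero] at h'
    exact (LinearMap.congr_fun h' x).symm
  · rw [HomogFunctor.IsWeight, not_not, LinearMap.range_eq_bot] at hα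
    rw [hα]
    rfl

/-! ### The endofunctor of the category of quantum polynomial functors -/

/-- The endofunctor `V_n^{⊗ d} ↦ V_{(k + 1) n}^{⊗ d}` of the source category. -/
def blowUpFunctor (hq : q ≠ 0) (k d : ℕ) : Source q d ⥤ Source q d where
  obj X := ⟨mulRank k X.rank⟩
  map f := blowUp hq (k + 1) f
  map_id X := blowUp_id hq (k + 1) X.rank d
  map_comp f g := blowUp_comp hq (k + 1) g f

instance (hq : q ≠ 0) (k d : ℕ) : (blowUpFunctor hq k d).Additive where
  map_add {_ _ f g} := blowUp_add hq (k + 1) f g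

instance (hq : q ≠ 0) (k d : ℕ) : (blowUpFunctor hq k d).Linear K where
  map_smul f c := blowUp_smul hq (k + 1) c f

/-- The endofunctor of the disjoint union of the source categories. -/
def totalBlowUp (hq : q ≠ 0) (k : ℕ) : TotalSource q ⥤ TotalSource q :=
  Sigma.Functor.sigma fun d => blowUpFunctor hq k d

theorem isQuantumPolynomial_totalBlowUp (hq : q ≠ 0) (k : ℕ) (A : QPFunctor q) :
    IsQuantumPolynomial q (totalBlowUp hq k ⋙ A.obj) := by
  refine ⟨fun d => ?_, A.property.2.subset ?_⟩
  · have h := A.property.1 d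
    have := h.1
    have := h.2
    change IsKLinear (blowUpFunctor hq k d ⋙ (Sigma.incl d ⋙ A.obj))
    exact ⟨inferInstance, inferInstance⟩
  · intro d hd h
    exact hd fun X => h ((blowUpFunctor hq k d).obj X)

/-- The endofunctor `A ↦ A((k + 1) n)` of the category of quantum polynomial functors. -/
def precompBlowUp (hq : q ≠ 0) (k : ℕ) : QPFunctor q ⥤ QPFunctor q :=
  ObjectProperty.lift _
    ((IsQuantumPolynomial q).ι ⋙ (Functor.whiskeringLeft _ _ _).obj (totalBlowUp hq k))
    (isQuantumPolynomial_totalBlowUp hq k)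

instance (hq : q ≠ 0) (k : ℕ) : (precompBlowUp hq k).PreservesZeroMorphisms where
  map_zero _ _ := rfl

/-- Precomposition is exact on all functors, exactness there being pointwise. The inclusion of the
quantum polynomial functors preserves kernels and cokernels and, being faithful, reflects exactness.
-/
theorem shortExact_precompBlowUp (hq : q ≠ 0) (k : ℕ) (S : ShortComplex (QPFunctor q))
    (hS : S.ShortExact) : (S.map (precompBlowUp hq k)).ShortExact := by
  have : (IsQuantumPolynomial q).ι.PreservesMonomorphisms :=
    ObjectProperty.preservesMonomorphisms_ι_of_isNormalEpiCategory _
  have : (IsQuantumPolynomial q).ι.PreservesEpimorphisms :=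
    ObjectProperty.preservesEpimorphisms_ι_of_isNormalMonoCategory _
  have : (IsQuantumPolynomial q).ι.PreservesHomology :=
    { preservesKernels := fun _ _ f => ObjectProperty.preservesKernels_ι _ f
      preservesCokernels := fun _ _ f => ObjectProperty.preservesCokernels_ι _ f }
  have := hS.mono_f
  have := hS.epi_g
  have h₁ := hS.map (IsQuantumPolynomial q).ι
  have h₂ := h₁.map_of_exact ((Functor.whiskeringLeft _ _ (FGModuleCat.{u} K)).obj
    (totalBlowUp hq k))
  have := h₂.mono_f
  have := h₂.epi_g
  refine ShortComplex.ShortExact.mk' ?_ ?_ ?_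
  · exact (IsQuantumPolynomial q).ι.reflects_exact_of_faithful _ h₂.exact
  · exact (IsQuantumPolynomial q).ι.mono_of_mono_map h₂.mono_f
  · exact (IsQuantumPolynomial q).ι.epi_of_epi_map h₂.epi_g

/-- The natural transformation `A(n) → A((k + 1) n)` induced by `diag`. -/
def toPrecompBlowUp (hq : q ≠ 0) {k : ℕ} (σ : Σ D : ℕ, Fin D → Fin (k + 1)) (A : QPFunctor q) :
    A ⟶ (precompBlowUp hq k).obj A :=
  ObjectProperty.homMk
    { app := fun X => A.obj.map (Sigma.SigmaHom.mk
        (Y := (blowUpFunctor hq k X.1).obj X.2) (diag hq σ X.2.rank X.1))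
      naturality := by
        rintro _ _ ⟨f⟩
        refine (A.obj.map_comp _ _).symm.trans (Eq.trans ?_ (A.obj.map_comp _ _))
        exact congrArg (fun g => A.obj.map (Sigma.SigmaHom.mk g)) (blowUp_diag hq σ f).symm }

theorem toPrecompBlowUp_naturality (hq : q ≠ 0) {k : ℕ} (σ : Σ D : ℕ, Fin D → Fin (k + 1))
    {A B : QPFunctor q} (f : A ⟶ B) :
    f ≫ toPrecompBlowUp hq σ B = toPrecompBlowUp hq σ A ≫ (precompBlowUp hq k).map f := by
  apply ObjectProperty.hom_ext
  refine NatTrans.ext (funext fun X => ?_)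
  exact (f.hom.naturality _).symm

theorem toPrecompBlowUp_eq_zero (hq : q ≠ 0) {k : ℕ} (σ : Σ D : ℕ, Fin D → Fin (k + 1))
    (hσ : Function.Surjective σ.2) (A : QPFunctor q)
    (hA : ∀ (n : ℕ+) (α : Fin n → ℕ), A.IsWeight n α →
      (Finset.univ.filter fun j => α j ≠ 0).card ≤ k) :
    toPrecompBlowUp hq σ A = 0 := by
  apply ObjectProperty.hom_ext
  refine NatTrans.ext (funext fun X => FGModuleCat.hom_ext ?_)
  exact (A.component X.1).act_diag_eq_zero hq (fun n α h => hA n α ⟨_, h⟩) σ hσ X.2.rank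

end BlowUp

/-! ### Splitting η on tensor products. -/

section Parabolic

variable {K : Type u} [Field K] {q : K}

/-! ### Maps that are linear over a parabolic subalgebra of the Hecke algebra -/

/-- The space of linear maps `V_n^{⊗ d} → V_m^{⊗ d}` that commute with the generators of the Hecke
algebra with indices in `I`. -/
def parabolic (q : K) (n m d : ℕ) (I : Set ℕ) :
    Submodule K (TensorSpace K n d →ₗ[K] TensorSpace K m d) where
  carrier := {f | ∀ (i : ℕ) (hi : i + 1 < d), i ∈ I →
    f ∘ₗ heckeT q n d i hi = heckeT q m d i hi ∘ₗ f}
  add_mem' := by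
    intro f g hf hg i hi h
    rw [LinearMap.add_comp, LinearMap.comp_add, hf i hi h, hg i hi h]
  zero_mem' := by
    intro i hi _
    rw [LinearMap.zero_comp, LinearMap.comp_zero]
  smul_mem' := by
    intro c f hf i hi h
    rw [LinearMap.smul_comp, LinearMap.comp_smul, hf i hi h]

theorem schur_le_parabolic (q : K) (n m d : ℕ) (I : Set ℕ) :
    schur q n m d ≤ parabolic q n m d I := fun _ hf i hi _ => hf i hi

theorem parabolic_le_schur (q : K) (n m d : ℕ) {I : Set ℕ} (hI : ∀ i, i + 1 < d → i ∈ I) :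
    parabolic q n m d I ≤ schur q n m d := fun _ hf i hi => hf i hi (hI i hi)

/-- A Hecke linear map as a map that is linear over a parabolic subalgebra. -/
abbrev toParabolic (I : Set ℕ) {n m d : ℕ} : schur q n m d →ₗ[K] parabolic q n m d I :=
  Submodule.inclusion (schur_le_parabolic q n m d I)

/-- The composition of maps that are linear over a parabolic subalgebra. -/
def parabolicComp {I : Set ℕ} {n r m d : ℕ} (g : parabolic q r m d I) (f : parabolic q n r d I) :
    parabolic q n m d I :=
  ⟨g.1 ∘ₗ f.1, fun i hi h => by
    rw [LinearMap.comp_assoc, f.2 i hi h, ← LinearMap.comp_assoc, g.2 i hi h,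
      LinearMap.comp_assoc]⟩

/-- The map sending `f₁ ⊗ f₂` to the tensor product of the linear maps `f₁` and `f₂`. -/
def parabolicTensor (q : K) (n m d₁ d₂ : ℕ) (I₁ I₂ : Set ℕ) :
    parabolic q n m d₁ I₁ ⊗[K] parabolic q n m d₂ I₂ →ₗ[K]
      (TensorSpace K n d₁ ⊗[K] TensorSpace K n d₂ →ₗ[K]
        TensorSpace K m d₁ ⊗[K] TensorSpace K m d₂) :=
  TensorProduct.homTensorHomMap (.id K) _ _ _ _ ∘ₗ
    TensorProduct.map (parabolic q n m d₁ I₁).subtype (parabolic q n m d₂ I₂).subtype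

@[simp]
theorem parabolicTensor_tmul (n m d₁ d₂ : ℕ) (I₁ I₂ : Set ℕ) (f₁ : parabolic q n m d₁ I₁)
    (f₂ : parabolic q n m d₂ I₂) :
    parabolicTensor q n m d₁ d₂ I₁ I₂ (f₁ ⊗ₜ f₂) = TensorProduct.map f₁.1 f₂.1 := rfl

theorem parabolicTensor_injective (q : K) (n m d₁ d₂ : ℕ) (I₁ I₂ : Set ℕ) :
    Function.Injective (parabolicTensor q n m d₁ d₂ I₁ I₂) :=
  (homTensorHomMap_injective _ _ _ _).comp
    (TensorProduct.map_injective_of_flat_flat _ _ (Submodule.subtype_injective _)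
      (Submodule.subtype_injective _))

/-- The parabolic Hom space is the common kernel of the commutators with the generators. Over a
field, tensoring with a space preserves such a kernel, so the conditions can be imposed on one
tensor factor after the other. -/
theorem mem_range_parabolicTensor (q : K) (n m d₁ d₂ : ℕ) (I₁ I₂ : Set ℕ)
    (g : TensorSpace K n d₁ ⊗[K] TensorSpace K n d₂ →ₗ[K]
      TensorSpace K m d₁ ⊗[K] TensorSpace K m d₂)
    (h₁ : ∀ (i : ℕ) (hi : i + 1 < d₁), i ∈ I₁ →
      g ∘ₗ TensorProduct.map (heckeT q n d₁ i hi) LinearMap.id =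
        TensorProduct.map (heckeT q m d₁ i hi) LinearMap.id ∘ₗ g)
    (h₂ : ∀ (i : ℕ) (hi : i + 1 < d₂), i ∈ I₂ →
      g ∘ₗ TensorProduct.map LinearMap.id (heckeT q n d₂ i hi) =
        TensorProduct.map LinearMap.id (heckeT q m d₂ i hi) ∘ₗ g) :
    g ∈ LinearMap.range (parabolicTensor q n m d₁ d₂ I₁ I₂) := by
  let φ (d : ℕ) (I : Set ℕ) (i : {i : ℕ // i + 1 < d ∧ i ∈ I}) :
      (TensorSpace K n d →ₗ[K] TensorSpace K m d) →ₗ[K]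
        (TensorSpace K n d →ₗ[K] TensorSpace K m d) :=
    LinearMap.lcomp K _ (heckeT q n d i.1 i.2.1) -
      LinearMap.llcomp K _ _ _ (heckeT q m d i.1 i.2.1)
  have hφ (d : ℕ) (I : Set ℕ) (f) (hf : ∀ i, φ d I i f = 0) : f ∈ parabolic q n m d I := by
    intro i hi h
    exact sub_eq_zero.1 (hf ⟨i, hi, h⟩)
  let H := TensorProduct.homTensorHomMap (.id K) (TensorSpace K n d₁) (TensorSpace K n d₂)
    (TensorSpace K m d₁) (TensorSpace K m d₂)
  have hH : Function.Injective H := homTensorHomMap_injective _ _ _ _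
  obtain ⟨x, rfl⟩ : ∃ x, H x = g :=
    ⟨(homTensorHomEquiv K _ _ _ _).symm g, by
      rw [← homTensorHomEquiv_apply, LinearEquiv.apply_symm_apply]⟩
  have k₁ (i) (z) : H ((φ d₁ I₁ i).rTensor _ z) =
      H z ∘ₗ TensorProduct.map (heckeT q n d₁ i.1 i.2.1) LinearMap.id -
        TensorProduct.map (heckeT q m d₁ i.1 i.2.1) LinearMap.id ∘ₗ H z := by
    induction z with
    | zero => simp
    | add a b ha hb =>
      rw [map_add, map_add, ha, hb, map_add, LinearMap.add_comp, LinearMap.comp_add]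
      abel
    | tmul a b =>
      refine TensorProduct.ext' fun v w => ?_
      simp [H, φ]
  have k₂ (i) (z) : H ((φ d₂ I₂ i).lTensor _ z) =
      H z ∘ₗ TensorProduct.map LinearMap.id (heckeT q n d₂ i.1 i.2.1) -
        TensorProduct.map LinearMap.id (heckeT q m d₂ i.1 i.2.1) ∘ₗ H z := by
    induction z with
    | zero => simp
    | add a b ha hb =>
      rw [map_add, map_add, ha, hb, map_add, LinearMap.add_comp, LinearMap.comp_add]
      abel
    | tmul a b =>
      refine TensorProduct.ext' fun v w => ?_
      simp [H, φ]
  obtain ⟨y, rfl⟩ := exists_rTensor_subtype (φ d₁ I₁) (parabolic q n m d₁ I₁) (hφ d₁ I₁) x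
    fun i => by
      apply hH
      rw [k₁, map_zero, h₁ _ _ i.2.2, sub_self]
  obtain ⟨z, rfl⟩ := exists_lTensor_subtype (φ d₂ I₂) (parabolic q n m d₂ I₂) (hφ d₂ I₂) y
    fun i => by
      apply Module.Flat.rTensor_preserves_injective_linearMap (parabolic q n m d₁ I₁).subtype
        (Submodule.subtype_injective _)
      apply hH
      have : (parabolic q n m d₁ I₁).subtype.rTensor _ ((φ d₂ I₂ i).lTensor _ y) =
          (φ d₂ I₂ i).lTensor _ ((parabolic q n m d₁ I₁).subtype.rTensor _ y) := by
        rw [← LinearMap.comp_apply, ← LinearMap.comp_apply, LinearMap.rTensor_comp_lTensor,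
          LinearMap.lTensor_comp_rTensor]
      rw [this, k₂, map_zero, map_zero, h₂ _ _ i.2.2, sub_self]
  refine ⟨z, ?_⟩
  exact congrArg H (LinearMap.congr_fun (LinearMap.rTensor_comp_lTensor _ _ _) z).symm

theorem concat_conj_mem_range_parabolicTensor (n m d₁ d₂ : ℕ) {I I₁ I₂ : Set ℕ}
    (hI₁ : ∀ i, i + 1 < d₁ → i ∈ I₁ → i ∈ I) (hI₂ : ∀ i, i + 1 < d₂ → i ∈ I₂ → d₁ + i ∈ I)
    (f : parabolic q n m (d₁ + d₂) I) :
    (concat K m d₁ d₂).symm.toLinearMap ∘ₗ f.1 ∘ₗ (concat K n d₁ d₂).toLinearMap ∈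
      LinearMap.range (parabolicTensor q n m d₁ d₂ I₁ I₂) := by
  apply mem_range_parabolicTensor
  · intro i hi h
    refine LinearMap.ext fun x => (concat K m d₁ d₂).injective ?_
    have e₁ (y) := LinearMap.congr_fun (heckeT_concat_left q n d₁ d₂ i hi) y
    have e₂ (y) := LinearMap.congr_fun (heckeT_concat_left q m d₁ d₂ i hi) y
    have e₃ (y) := LinearMap.congr_fun (f.2 i (by omega) (hI₁ i hi h)) y
    simp only [LinearMap.comp_apply, LinearEquiv.coe_coe] at e₁ e₂ e₃ ⊢
    rw [LinearEquiv.apply_symm_apply, ← e₁, e₃, ← e₂, LinearEquiv.apply_symm_apply]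
  · intro i hi h
    refine LinearMap.ext fun x => (concat K m d₁ d₂).injective ?_
    have e₁ (y) := LinearMap.congr_fun (heckeT_concat_right q n d₁ d₂ i hi) y
    have e₂ (y) := LinearMap.congr_fun (heckeT_concat_right q m d₁ d₂ i hi) y
    have e₃ (y) := LinearMap.congr_fun (f.2 (d₁ + i) (by omega) (hI₂ i hi h)) y
    simp only [LinearMap.comp_apply, LinearEquiv.coe_coe] at e₁ e₂ e₃ ⊢
    rw [LinearEquiv.apply_symm_apply, ← e₁, e₃, ← e₂, LinearEquiv.apply_symm_apply]

/-- The decomposition of a map that is linear over a parabolic subalgebra. -/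
def parabolicComul (n m d₁ d₂ : ℕ) {I I₁ I₂ : Set ℕ}
    (hI₁ : ∀ i, i + 1 < d₁ → i ∈ I₁ → i ∈ I) (hI₂ : ∀ i, i + 1 < d₂ → i ∈ I₂ → d₁ + i ∈ I) :
    parabolic q n m (d₁ + d₂) I →ₗ[K] parabolic q n m d₁ I₁ ⊗[K] parabolic q n m d₂ I₂ :=
  (LinearEquiv.ofInjective (parabolicTensor q n m d₁ d₂ I₁ I₂)
      (parabolicTensor_injective q n m d₁ d₂ I₁ I₂)).symm.toLinearMap ∘ₗ
    LinearMap.codRestrict _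
      (LinearMap.llcomp K _ _ _ (concat K m d₁ d₂).symm.toLinearMap ∘ₗ
        LinearMap.lcomp K _ (concat K n d₁ d₂).toLinearMap ∘ₗ
          (parabolic q n m (d₁ + d₂) I).subtype)
      (concat_conj_mem_range_parabolicTensor n m d₁ d₂ hI₁ hI₂)

theorem parabolicTensor_parabolicComul (n m d₁ d₂ : ℕ) {I I₁ I₂ : Set ℕ}
    (hI₁ : ∀ i, i + 1 < d₁ → i ∈ I₁ → i ∈ I) (hI₂ : ∀ i, i + 1 < d₂ → i ∈ I₂ → d₁ + i ∈ I)
    (f : parabolic q n m (d₁ + d₂) I) :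
    parabolicTensor q n m d₁ d₂ I₁ I₂ (parabolicComul n m d₁ d₂ hI₁ hI₂ f) =
      (concat K m d₁ d₂).symm.toLinearMap ∘ₗ f.1 ∘ₗ (concat K n d₁ d₂).toLinearMap :=
  congrArg Subtype.val (LinearEquiv.apply_symm_apply
    (LinearEquiv.ofInjective (parabolicTensor q n m d₁ d₂ I₁ I₂)
      (parabolicTensor_injective q n m d₁ d₂ I₁ I₂)) _)

/-- An extension of the action of Hecke linear maps on the values of `F` to the maps that are
linear over a parabolic subalgebra. -/
structure ParabolicExtension {d : ℕ} (F : HomogFunctor q d) (I : Set ℕ) where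
  /-- The action of maps that are linear over the parabolic subalgebra. -/
  act (n m : ℕ+) : parabolic q n m d I →ₗ[K] F.val n →ₗ[K] F.val m
  act_comp (n r m : ℕ+) (g : parabolic q r m d I) (f : parabolic q n r d I) :
    act n m (parabolicComp g f) = act r m g ∘ₗ act n r f
  act_toParabolic (n m : ℕ+) (f : schur q n m d) : act n m (toParabolic I f) = F.act n m f

namespace ParabolicExtension

/-- The extension for the whole Hecke algebra. -/
def ofForall {d : ℕ} (F : HomogFunctor q d) {I : Set ℕ} (hI : ∀ i, i + 1 < d → i ∈ I) :
    ParabolicExtension F I where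
  act n m := F.act n m ∘ₗ Submodule.inclusion (parabolic_le_schur q n m d hI)
  act_comp n r m g f := F.act_comp n r m (Submodule.inclusion (parabolic_le_schur q r m d hI) g)
    (Submodule.inclusion (parabolic_le_schur q n r d hI) f)
  act_toParabolic _ _ _ := rfl

section Tensor

variable {d₁ d₂ : ℕ} {F : HomogFunctor q d₁} {G : HomogFunctor q d₂} {I I₁ I₂ : Set ℕ}

/-- The map sending `f₁ ⊗ f₂` to the tensor product of the actions of `f₁` and `f₂`. -/
def tensorAct (E₁ : ParabolicExtension F I₁) (E₂ : ParabolicExtension G I₂) (n m : ℕ+) :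
    parabolic q n m d₁ I₁ ⊗[K] parabolic q n m d₂ I₂ →ₗ[K]
      (F.val n ⊗[K] G.val n →ₗ[K] F.val m ⊗[K] G.val m) :=
  TensorProduct.homTensorHomMap (.id K) _ _ _ _ ∘ₗ TensorProduct.map (E₁.act n m) (E₂.act n m)

@[simp]
theorem tensorAct_tmul (E₁ : ParabolicExtension F I₁) (E₂ : ParabolicExtension G I₂) (n m : ℕ+)
    (f₁ : parabolic q n m d₁ I₁) (f₂ : parabolic q n m d₂ I₂) :
    E₁.tensorAct E₂ n m (f₁ ⊗ₜ f₂) = TensorProduct.map (E₁.act n m f₁) (E₂.act n m f₂) := rfl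

/-- A single z represents the composite both as a linear map and as an action. Injectivity of
`parabolicTensor` then identifies z with the decomposition of a composite, so that no product on the
tensor spaces has to be defined. -/
theorem exists_parabolicTensor_comp (E₁ : ParabolicExtension F I₁) (E₂ : ParabolicExtension G I₂)
    (n r m : ℕ+) (y : parabolic q r m d₁ I₁ ⊗[K] parabolic q r m d₂ I₂)
    (x : parabolic q n r d₁ I₁ ⊗[K] parabolic q n r d₂ I₂) :
    ∃ z, parabolicTensor q n m d₁ d₂ I₁ I₂ z =
        parabolicTensor q r m d₁ d₂ I₁ I₂ y ∘ₗ parabolicTensor q n r d₁ d₂ I₁ I₂ x ∧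
      E₁.tensorAct E₂ n m z = E₁.tensorAct E₂ r m y ∘ₗ E₁.tensorAct E₂ n r x := by
  induction y with
  | zero => exact ⟨0, by simp, by simp⟩
  | add y y' hy hy' =>
    obtain ⟨z, h₁, h₂⟩ := hy
    obtain ⟨z', h₁', h₂'⟩ := hy'
    exact ⟨z + z', by rw [map_add, map_add, h₁, h₁', LinearMap.add_comp],
      by rw [map_add, map_add, h₂, h₂', LinearMap.add_comp]⟩
  | tmul g₁ g₂ =>
    induction x with
    | zero => exact ⟨0, by simp, by simp⟩
    | add x x' hx hx' =>
      obtain ⟨z, h₁, h₂⟩ := hx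
      obtain ⟨z', h₁', h₂'⟩ := hx'
      exact ⟨z + z', by rw [map_add, map_add, h₁, h₁', LinearMap.comp_add],
        by rw [map_add, map_add, h₂, h₂', LinearMap.comp_add]⟩
    | tmul f₁ f₂ =>
      refine ⟨parabolicComp g₁ f₁ ⊗ₜ parabolicComp g₂ f₂, ?_, ?_⟩
      · simp only [parabolicTensor_tmul, parabolicComp, TensorProduct.map_comp]
      · simp only [tensorAct_tmul, act_comp, TensorProduct.map_comp]

/-- The extension of the action on a tensor product. -/
def tensor (E₁ : ParabolicExtension F I₁) (E₂ : ParabolicExtension G I₂)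
    (hI₁ : ∀ i, i + 1 < d₁ → i ∈ I₁ → i ∈ I) (hI₂ : ∀ i, i + 1 < d₂ → i ∈ I₂ → d₁ + i ∈ I) :
    ParabolicExtension (F.tensor G) I where
  act n m := E₁.tensorAct E₂ n m ∘ₗ parabolicComul n m d₁ d₂ hI₁ hI₂
  act_comp n r m g f := by
    obtain ⟨z, h₁, h₂⟩ := exists_parabolicTensor_comp E₁ E₂ n r m
      (parabolicComul r m d₁ d₂ hI₁ hI₂ g) (parabolicComul n r d₁ d₂ hI₁ hI₂ f)
    have : parabolicComul n m d₁ d₂ hI₁ hI₂ (parabolicComp g f) = z := by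
      apply parabolicTensor_injective
      rw [h₁, parabolicTensor_parabolicComul, parabolicTensor_parabolicComul,
        parabolicTensor_parabolicComul]
      refine LinearMap.ext fun x => ?_
      simp [parabolicComp]
    exact (congrArg (E₁.tensorAct E₂ n m) this).trans h₂
  act_toParabolic n m f := by
    have h₁ (z : schur q n m d₁ ⊗[K] schur q n m d₂) :
        parabolicTensor q n m d₁ d₂ I₁ I₂ (TensorProduct.map (toParabolic I₁) (toParabolic I₂) z) =
          schurTensor q n m d₁ d₂ z := by
      induction z with
      | zero => simp
      | add x y hx hy => rw [map_add, map_add, map_add, hx, hy]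
      | tmul x y => rfl
    have h₂ (z : schur q n m d₁ ⊗[K] schur q n m d₂) :
        E₁.tensorAct E₂ n m (TensorProduct.map (toParabolic I₁) (toParabolic I₂) z) =
          QuantumFunctor.tensorAct F G n m z := by
      induction z with
      | zero => simp
      | add x y hx hy => rw [map_add, map_add, map_add, hx, hy]
      | tmul x y =>
        rw [TensorProduct.map_tmul, tensorAct_tmul, QuantumFunctor.tensorAct_tmul,
          act_toParabolic, act_toParabolic]
    -- On Hecke linear maps the parabolic decomposition is the comultiplication: both represent the
    -- same linear map, and representation is injective.
    have : parabolicComul n m d₁ d₂ hI₁ hI₂ (toParabolic I f) =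
        TensorProduct.map (toParabolic I₁) (toParabolic I₂) (schurComul q n m d₁ d₂ f) := by
      apply parabolicTensor_injective
      rw [parabolicTensor_parabolicComul, h₁, schurTensor_schurComul]
      rfl
    exact (congrArg (E₁.tensorAct E₂ n m) this).trans (h₂ _)

end Tensor

end ParabolicExtension

/-! ### The word of blocks of an iterated tensor product -/

/-- The word `0 ⋯ 0 1 ⋯ 1 ⋯ k ⋯ k` in which the letter `i` occurs `d i` times. -/
def blockIndex : (k : ℕ) → (d : Fin (k + 1) → ℕ) → Fin (totalDegree k d) → Fin (k + 1)
  | 0, _ => fun _ => 0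
  | k + 1, d => Fin.append (fun _ : Fin (d 0) => 0) fun t => (blockIndex k (fun i => d i.succ) t).succ

theorem noDescent_append {b m n : ℕ} {v : Fin m → Fin b} {w : Fin n → Fin b} (hv : NoDescent v)
    (hw : NoDescent w) (h : ∀ s t, v s ≤ w t) : NoDescent (Fin.append v w) := by
  intro i hi
  rcases Nat.lt_or_ge (i + 1) m with hm | hm
  · have e₁ := Fin.append_left v w ⟨i, by omega⟩
    have e₂ := Fin.append_left v w ⟨i + 1, hm⟩
    exact e₁.trans_le ((hv i hm).trans_eq e₂.symm)
  have e₂ := Fin.append_right v w ⟨i + 1 - m, by omega⟩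
  rw [show Fin.natAdd m ⟨i + 1 - m, by omega⟩ = (⟨i + 1, hi⟩ : Fin (m + n)) from
    Fin.ext (by simp; omega)] at e₂
  rw [e₂]
  rcases Nat.lt_or_ge i m with hm' | hm'
  · exact (Fin.append_left v w ⟨i, hm'⟩).trans_le (h _ _)
  · obtain ⟨j, rfl⟩ := Nat.exists_eq_add_of_le hm'
    refine (Fin.append_right v w ⟨j, by omega⟩).trans_le ((hw j (by omega)).trans_eq ?_)
    exact congrArg w (Fin.ext (by simp; omega))

theorem noDescent_blockIndex (k : ℕ) (d : Fin (k + 1) → ℕ) : NoDescent (blockIndex k d) := by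
  induction k with
  | zero => exact fun _ _ => le_rfl
  | succ k ih =>
    refine noDescent_append (fun _ _ => le_rfl) (fun i hi => ?_) fun _ _ => Fin.zero_le _
    exact Fin.succ_le_succ_iff.2 (ih _ i hi)

/-- Here the degrees ≥ 1 enter: block i occupies `d i` positions, so none is missing. -/
theorem surjective_blockIndex (k : ℕ) (d : Fin (k + 1) → ℕ) (hd : ∀ i, 1 ≤ d i) :
    Function.Surjective (blockIndex k d) := by
  induction k with
  | zero => exact fun c => ⟨⟨0, hd 0⟩, Subsingleton.elim (α := Fin 1) _ _⟩
  | succ k ih =>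
    intro c
    induction c using Fin.cases with
    | zero => exact ⟨Fin.castAdd _ ⟨0, hd 0⟩, Fin.append_left _ _ _⟩
    | succ c =>
      obtain ⟨t, rfl⟩ := ih _ (fun i => hd i.succ) c
      exact ⟨Fin.natAdd _ t, Fin.append_right _ _ _⟩

/-- The positions at which a word has the same letter as at the next position. -/
def plateau {b d : ℕ} (β : Fin d → Fin b) : Set ℕ :=
  {i | ∃ hi : i + 1 < d, β ⟨i, Nat.lt_of_succ_lt hi⟩ = β ⟨i + 1, hi⟩}

/-- The action of the parabolic subalgebra `H_{d_0} ⊗ ⋯ ⊗ H_{d_k}` on an iterated tensor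
product. -/
def tensorAllExtension : (k : ℕ) → (d : Fin (k + 1) → ℕ) →
    (F : (i : Fin (k + 1)) → HomogFunctor q (d i)) →
    ParabolicExtension (tensorAll k d F) (plateau (blockIndex k d))
  | 0, _, F => ParabolicExtension.ofForall (F 0) fun _ hi => ⟨hi, rfl⟩
  | k + 1, d, F =>
    -- Positions inside the first factor all lie in block 0, and those of the other factors are
    -- shifted by `d 0`. Nothing is asked at the boundary position `d 0 - 1`, where the block
    -- changes.
    ParabolicExtension.tensor (I₁ := Set.univ)
      (ParabolicExtension.ofForall (F 0) fun _ _ => Set.mem_univ _)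
      (tensorAllExtension k (fun i => d i.succ) fun i => F i.succ)
      (fun i hi _ => ⟨by change i + 1 < d 0 + _; omega,
        (Fin.append_left _ _ ⟨i, by omega⟩).trans (Fin.append_left (fun _ => (0 : Fin (k + 2)))
          (fun t => (blockIndex k (fun i => d i.succ) t).succ) ⟨i + 1, hi⟩).symm⟩)
      (fun i hi h => ⟨by change d 0 + i + 1 < d 0 + _; omega,
        (Fin.append_right _ _ ⟨i, by omega⟩).trans ((congrArg Fin.succ h.2).trans
          (Fin.append_right (fun _ : Fin (d 0) => (0 : Fin (k + 2)))
            (fun t => (blockIndex k (fun i => d i.succ) t).succ) ⟨i + 1, hi⟩).symm)⟩)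

/-! ### The retraction -/

/-- The projection `valT K n β` commutes only with the T_i at plateaus of β, so it acts on F through
E alone. It intertwines `blowUp f` with f and is a left inverse of `diag`, because β is sorted;
functoriality of E turns this into a natural left inverse. -/
theorem exists_retraction_homog (hq : q ≠ 0) {k D : ℕ} (F : HomogFunctor q D)
    {β : Fin D → Fin (k + 1)} (hβ : NoDescent β) (E : ParabolicExtension F (plateau β)) :
    ∃ ρ : blowUpFunctor hq k D ⋙ F.obj ⟶ F.obj, ∀ X : Source q D,
      F.obj.map (X := X) (Y := (blowUpFunctor hq k D).obj X) (diag hq ⟨D, β⟩ X.rank D) ≫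
        ρ.app X = 𝟙 _ := by
  let p (n : ℕ+) : parabolic q (mulRank k n) n D (plateau β) :=
    ⟨valT K n β, fun i hi h => LinearMap.ext fun x => valT_heckeT_of_eq q i hi β h.2 x⟩
  refine ⟨{ app := fun X => FGModuleCat.ofHom (E.act (mulRank k X.rank) X.rank (p X.rank))
            naturality := fun X Y f => FGModuleCat.hom_ext ?_ }, fun X => FGModuleCat.hom_ext ?_⟩
  · have key (g : schur q (mulRank k X.rank) (mulRank k Y.rank) D)
        (hg : ∀ x, valT K Y.rank β (g.1 x) = f.1 (valT K X.rank β x)) :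
        E.act _ _ (p Y.rank) ∘ₗ F.act _ _ g = F.act X.rank Y.rank f ∘ₗ E.act _ _ (p X.rank) := by
      rw [← E.act_toParabolic, ← E.act_toParabolic, ← E.act_comp, ← E.act_comp]
      exact congrArg (E.act _ _) (Subtype.ext (LinearMap.ext hg))
    exact key _ (valT_blowUp hq f hβ)
  · have key (g : schur q X.rank (mulRank k X.rank) D) (hg : ∀ x, valT K X.rank β (g.1 x) = x) :
        E.act _ _ (p X.rank) ∘ₗ F.act _ _ g = LinearMap.id := by
      rw [← E.act_toParabolic, ← E.act_comp, ← F.act_id, ← E.act_toParabolic]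
      exact congrArg (E.act _ _) (Subtype.ext (LinearMap.ext hg))
    exact key _ fun x => (valT_diag hq ⟨D, β⟩ X.rank D hβ x).trans (if_pos rfl)

/-- Outside degree D the values of A are zero objects, so any map splits there. -/
theorem exists_retraction_of_component (hq : q ≠ 0) {k D : ℕ} (σ : Σ D : ℕ, Fin D → Fin (k + 1))
    (A : QPFunctor q) (hA : ∀ e, e ≠ D → ∀ X : Source q e, IsZero (A.obj.obj ⟨e, X⟩))
    (h : ∃ ρ : blowUpFunctor hq k D ⋙ (Sigma.incl D ⋙ A.obj) ⟶ Sigma.incl D ⋙ A.obj,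
      ∀ X : Source q D, (Sigma.incl D ⋙ A.obj).map (X := X)
        (Y := (blowUpFunctor hq k D).obj X) (diag hq σ X.rank D) ≫ ρ.app X = 𝟙 _) :
    ∃ ρ : (precompBlowUp hq k).obj A ⟶ A, toPrecompBlowUp hq σ A ≫ ρ = 𝟙 A := by
  obtain ⟨ρ, hρ⟩ := h
  let τ (e : ℕ) : blowUpFunctor hq k e ⋙ (Sigma.incl e ⋙ A.obj) ⟶ Sigma.incl e ⋙ A.obj :=
    -- Zero serves as the default in the other degrees.
    if h : e = D then h ▸ ρ else 0
  refine ⟨ObjectProperty.homMk (Sigma.natTrans τ), ?_⟩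
  apply ObjectProperty.hom_ext
  refine NatTrans.ext (funext fun X => ?_)
  obtain ⟨e, X⟩ := X
  by_cases h : e = D
  · subst h
    have : τ e = ρ := dif_pos rfl
    change A.obj.map _ ≫ (τ e).app X = 𝟙 _
    rw [this]
    exact hρ X
  · exact (hA e h X).eq_of_tgt _ _

theorem exists_retraction (hq : q ≠ 0) {k D : ℕ} (F : HomogFunctor q D)
    {β : Fin D → Fin (k + 1)} (hβ : NoDescent β) (E : ParabolicExtension F (plateau β)) :
    ∃ ρ : (precompBlowUp hq k).obj F.toQP ⟶ F.toQP,
      toPrecompBlowUp hq ⟨D, β⟩ F.toQP ≫ ρ = 𝟙 F.toQP := by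
  refine exists_retraction_of_component hq ⟨D, β⟩ F.toQP (D := D) (fun e he X => ?_) ?_
  · change IsZero ((Function.update (fun e => (Functor.const (Source q e)).obj
      (FGModuleCat.of K PUnit.{u + 1})) D F.obj e).obj X)
    rw [Function.update_of_ne he, IsZero.iff_id_eq_zero]
    exact FGModuleCat.hom_ext (LinearMap.ext fun _ => rfl)
  · have h : Sigma.incl D ⋙ F.toQP.obj = F.obj :=
      Eq.trans (b := Function.update (fun e => (Functor.const (Source q e)).obj
        (FGModuleCat.of K PUnit.{u + 1})) D F.obj D) rfl (Function.update_self ..)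
    rw [h]
    exact exists_retraction_homog hq F hβ E

end Parabolic

end QuantumFunctor

end
theorem mainTheorem11 {K : Type u} [Field K] (q : K) (hq : q ≠ 0) (k : ℕ)
    (A : QuantumFunctor.QPFunctor q)
    (hA : ∀ (n : ℕ+) (α : Fin n → ℕ), A.IsWeight n α →
      (Finset.univ.filter fun j => α j ≠ 0).card ≤ k)
    (d : Fin (k + 1) → ℕ) (hd : ∀ i, 1 ≤ d i)
    (F : (i : Fin (k + 1)) → QuantumFunctor.HomogFunctor q (d i)) (s : ℕ) :
    Subsingleton (Abelian.Ext A (QuantumFunctor.tensorAll k d F).toQP s) := by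
  obtain ⟨ρ, hρ⟩ := QuantumFunctor.exists_retraction hq (QuantumFunctor.tensorAll k d F)
    (QuantumFunctor.noDescent_blockIndex k d) (QuantumFunctor.tensorAllExtension k d F)
  exact Abelian.Ext.subsingleton_of_retraction (QuantumFunctor.precompBlowUp hq k)
    (QuantumFunctor.shortExact_precompBlowUp hq k) (QuantumFunctor.toPrecompBlowUp hq _)
    (QuantumFunctor.toPrecompBlowUp_naturality hq _)
    (QuantumFunctor.toPrecompBlowUp_eq_zero hq _
      (QuantumFunctor.surjective_blockIndex k d hd) A hA) ρ hρ s
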